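/- Let $\mathbb{F}_q$ be a finite field, $\vartheta:\mathbb{F}_q^+\to\mathbb{C}^\times$ a nontrivial homomorphism, and $\mu\vdash n$ a partition with conjugate $\mu'$. Let $\mathrm{UT}_n(\mathbb{F}_q)\subseteq\mathrm{GL}_n(\mathbb{F}_q)$ be the group of unipotent upper triangular matrices. *Supercharacters.* For a nonnesting set partition $\eta$ of $\{1,\dots,n\}$, given by its set of arcs $i\frown j$ ($i<j$), let $$U_\eta=\{u\in \mathrm{UT}_n(\mathbb{F}_q)\mid u_{jk}=0 \text{ if } j<k \text{ and there is } i\frown l\in\eta-\{j\frown k\}\text{ with } i\le j<k\le l\},$$ $\gamma_\eta(u)=\prod_{i\frown j\in\eta}\vartheta(u_{ij})$, and $\chi^{\eta}_{\mathrm{nn}}=\mathrm{Ind}_{U_\eta}^{\mathrm{UT}_n(\mathbb{F}_q)}(\gamma_\eta)$. *The tableau.* Let $T$ be the column reading tableau of the Ferrers diagram of $\mu$ (the numbers $1,\dots,n$ are entered down the columns, from left to right), and let $\mathrm{sp}(T)$ be the (nonnesting) set partition whose arcs join horizontally adjacent entries of $T$. Let $V_T$ be the subgroup of those $u\in\mathrm{UT}_n(\mathbb{F}_q)$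 such that $(u-\mathrm{Id})_{ij}\ne0$ implies that there is an arc $i\frown k\in\mathrm{sp}(T)$ with $i<j<k$ and $i$ is in a strictly higher row of $T$ than $j$. Let $U_T=V_T\ltimes U_{\mathrm{sp}(T)}$. *Generalized Gelfand--Graev characters.* For a composition $\alpha$ of $n$ let $U_\alpha$ be the group of block upper triangular matrices with identity diagonal blocks of sizes $\alpha_1,\alpha_2,\dots$. Let $\mathrm{ctr}(\mu')$ be the composition of $n$ obtained by listing the column lengths $\mu'_1,\mu'_2,\dots$ of $\mu$ in the following order: first those with even index, by decreasing index, then those with odd index, by increasing index. Centre the rows of the Ferrers diagram of $\mu$, and number its boxes down the consecutive half-columns, from left to right; let $\mathrm{ggg}(\mu)$ be the set of arcs that join horizontally adjacent entries of this filling. Then $\Gamma_\mu=\mathrm{Ind}_{U_{\mathrm{ctr}(\mu')}}^{\mathrm{GL}_n(\mathbb{F}_q)}(\gamma_\mu)$, where $\gamma_\mu(u)=\prod_{i\frown j\in \mathrm{ggg}(\mu)}\vartheta(u_{ij})$. **Statement.** 1. The map $\gamma_{\mathrm{sp}(T)}(u)=\prod_{i\frown j\in\mathrm{sp}(T)}\vartheta(u_{ij})$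 is a linear character of $U_T$, and $$\frac1{|V_T|}\,\chi_{\mathrm{nn}}^{\mathrm{sp}(T)}=\mathrm{Ind}_{U_T}^{\mathrm{UT}_n(\mathbb{F}_q)}(\gamma_{\mathrm{sp}(T)}).$$ 2. $\frac1{|V_T|}\,\chi_{\mathrm{nn}}^{\mathrm{sp}(T)}$ is the character of a finite-dimensional complex representation of $\mathrm{UT}_n(\mathbb{F}_q)$. 3. Unless $\mu=(1^n)$ with $n\ge2$, $$\mathrm{Ind}_{\mathrm{UT}_n(\mathbb{F}_q)}^{\mathrm{GL}_n(\mathbb{F}_q)}\Big(\frac1{|V_T|}\,\chi_{\mathrm{nn}}^{\mathrm{sp}(T)}\Big)=\Gamma_\mu .$$ -/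

import Mathlib

namespace GGG

noncomputable section

/-! ### Class functions and characters -/

open Classical in
/-- The function on `G` induced from a function `f` on a subgroup `H` of the finite group `G`:
`Ind_H^G f (g) = |H|⁻¹ ∑_{x ∈ G, x g x⁻¹ ∈ H} f (x g x⁻¹)`. -/
def ind {G : Type*} [Group G] [Finite G] (H : Subgroup G) (f : H → ℂ) : G → ℂ :=
  fun g => (Nat.card H : ℂ)⁻¹ *
    ∑ᶠ x : G, if h : x * g * x⁻¹ ∈ H then f ⟨x * g * x⁻¹, h⟩ else 0

/-- `f` is the character of a finite-dimensional complex representation of `G`. -/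
def IsCharacter {G : Type*} [Group G] (f : G → ℂ) : Prop :=
  ∃ (d : ℕ) (ρ : Representation ℂ G (Fin d → ℂ)), ∀ g, ρ.character g = f g

/-! ### Unipotent groups -/

section Groups

variable (n : ℕ) (F : Type*) [Field F] [Finite F]

/-- `S` is closed under multiplication and contains `1` in a finite group: it is a subgroup. -/
def subgroupOfMulMem {G : Type*} [Group G] [Finite G] (S : Set G) (h1 : (1 : G) ∈ S)
    (hmul : ∀ {a b : G}, a ∈ S → b ∈ S → a * b ∈ S) : Subgroup G where
  carrier := S
  one_mem' := h1
  mul_mem' := hmul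
  inv_mem' := by
    intro a ha
    let M : Submonoid G := ⟨⟨S, hmul⟩, h1⟩
    have h : a⁻¹ ∈ Submonoid.powers a :=
      (isOfFinOrder_of_finite a).mem_powers_iff_mem_zpowers.2
        (Subgroup.inv_mem _ (Subgroup.mem_zpowers a))
    exact (Submonoid.powers_le.2 (show a ∈ M from ha)) h

lemma sub_one_entry {n : ℕ} {F : Type*} [Field F] (a b : GL (Fin n) F) (i j : Fin n)
    (h : ((a * b : GL (Fin n) F).1 - 1) i j ≠ 0) :
    (a.1 - 1) i j ≠ 0 ∨ (b.1 - 1) i j ≠ 0 ∨ ∃ k, (a.1 - 1) i k ≠ 0 ∧ (b.1 - 1) k j ≠ 0 := by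
  by_contra hc
  push Not at hc
  obtain ⟨h1, h2, h3⟩ := hc
  apply h
  have : (a * b : GL (Fin n) F).1 - 1 = (a.1 - 1) * (b.1 - 1) + (a.1 - 1) + (b.1 - 1) := by
    rw [Units.val_mul]; noncomm_ring
  rw [this, Matrix.add_apply, Matrix.add_apply, h1, h2, Matrix.mul_apply, add_zero, add_zero]
  refine Finset.sum_eq_zero fun k _ => ?_
  by_cases hk : (a.1 - 1) i k = 0
  · rw [hk, zero_mul]
  · rw [h3 k hk, mul_zero]

/-- `UT_n(F)`: the unipotent upper triangular matrices. -/
def UT : Subgroup (GL (Fin n) F) :=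
  subgroupOfMulMem {g | ∀ i j, (g.1 - 1) i j ≠ 0 → i < j} (by simp) (by
    intro a b ha hb i j h
    rcases sub_one_entry a b i j h with h | h | ⟨k, h, h'⟩
    · exact ha _ _ h
    · exact hb _ _ h
    · exact (ha _ _ h).trans (hb _ _ h'))

variable {n}

/-- The subgroup of `UT_n(F)` of all `u` such that `(u - 1)_{ij} ≠ 0` implies `P i j`, for a
transitive relation `P`. -/
def patternSubgroup (P : Fin n → Fin n → Prop)
    (hP : ∀ i j k, i < j → j < k → P i j → P j k → P i k) : Subgroup (UT n F) :=
  subgroupOfMulMem {u | ∀ i j, (u.1.1 - 1) i j ≠ 0 → P i j} (by simp) (by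
    intro a b ha hb i j h
    rcases sub_one_entry a.1 b.1 i j h with h | h | ⟨k, h, h'⟩
    · exact ha _ _ h
    · exact hb _ _ h
    · exact hP _ _ _ (a.2 _ _ h) (b.2 _ _ h') (ha _ _ h) (hb _ _ h'))

/-- `U_α` for an integer composition `α` (a list of block sizes) of `n`: the off-diagonal nonzero
entries of its elements are at positions `(i, j)` with `i` in a strictly earlier block than `j`,
that is, separated from `j` by a partial sum of `α` (indices start from `0`). -/
def compositionSubgroup (α : List ℕ) : Subgroup (UT n F) :=
  patternSubgroup F (fun i j => ∃ k, (i : ℕ) < (α.take k).sum ∧ (α.take k).sum ≤ (j : ℕ)) (by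
    rintro i j k _ hjk ⟨a, h1, h2⟩ _
    exact ⟨a, h1, h2.trans (le_of_lt hjk)⟩)

end Groups

/-- A nonnesting set partition of `{0, …, n-1}`, given by its arcs `i ⌢ j`, `i < j`. -/
structure NonnestingSetPartition (n : ℕ) where
  arcs : Finset (Fin n × Fin n)
  lt : ∀ a ∈ arcs, a.1 < a.2
  eq_iff : ∀ a ∈ arcs, ∀ b ∈ arcs, a.1 = b.1 ↔ a.2 = b.2
  nonnesting : ∀ a ∈ arcs, ∀ b ∈ arcs, ¬ (a.1 < b.1 ∧ b.2 < a.2)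

section Characters

variable {n : ℕ} {F : Type*} [Field F]

/-- `u ↦ ∏_{i ⌢ j ∈ η} ϑ(u_{ij})`. -/
def gam (ϑ : AddChar F ℂ) (η : Finset (Fin n × Fin n)) (u : GL (Fin n) F) : ℂ :=
  ∏ a ∈ η, ϑ (u.1 a.1 a.2)

variable [Finite F]

variable (F) in
/-- `U_η`: all `u ∈ UT_n(F)` with `u_{jk} = 0` for `j < k` whenever there is an arc
`i ⌢ l ∈ η - {j ⌢ k}` with `i ≤ j < k ≤ l`. -/
def setPartitionSubgroup (η : NonnestingSetPartition n) : Subgroup (UT n F) :=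
  patternSubgroup F (fun j k => ¬ ∃ a ∈ η.arcs, a ≠ (j, k) ∧ a.1 ≤ j ∧ k ≤ a.2) (by
    rintro i j k hij hjk h _ ⟨a, ha, _, h1, h2⟩
    refine h ⟨a, ha, ?_, h1, hjk.le.trans h2⟩
    rintro rfl
    exact absurd h2 (not_le.2 hjk))

/-- The nonnesting supercharacter `χ_nn^η = Ind_{U_η}^{UT_n(F)} γ_η`. -/
def supercharacter (ϑ : AddChar F ℂ) (η : NonnestingSetPartition n) : UT n F → ℂ :=
  ind (setPartitionSubgroup F η) (fun u => gam ϑ η.arcs u.1.1)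

end Characters

/-! ### Tableaux

The cell in row `r` and column `c` (both from `0`, rows numbered from North to South, columns from
West to East) of a Young diagram `μ` is `(r, c)`; `μ.rowLen r` are the parts of `μ` and
`μ.colLen c` those of its conjugate. Tableau entries are `0, …, n-1` with `n = μ.card`. -/

section Tableaux

variable (μ : YoungDiagram)

/-- The filling of `μ` that numbers its cells increasingly along a reading order, given by a key
in a linear order. -/
def reading (key : ℕ × ℕ → ℕ ×ₗ ℕ) (c : ℕ × ℕ) : ℕ :=
  (μ.cells.filter fun d => key d < key c).card

/-- Reading down the columns of the left-justified diagram, from West to East. -/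
def colKey (c : ℕ × ℕ) : ℕ ×ₗ ℕ := toLex (c.2, c.1)

/-- Reading down the half-columns, from West to East, of the diagram with centred rows. The cell
`(r, c)` has horizontal coordinate `c + (μ_1 - μ_r) / 2` there; the key uses its double. -/
def halfColKey (c : ℕ × ℕ) : ℕ ×ₗ ℕ :=
  toLex (2 * c.2 + (μ.rowLen 0 - μ.rowLen c.1), c.1)

open Classical in
/-- The arcs `i ⌢ j` joining the entries of horizontally adjacent cells of a filling `T` of `μ`. -/
def rowArcs (T : ℕ × ℕ → ℕ) : Finset (Fin μ.card × Fin μ.card) :=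
  Finset.univ.filter fun a => ∃ r c, (r, c) ∈ μ ∧ (r, c + 1) ∈ μ ∧
    T (r, c) = a.1 ∧ T (r, c + 1) = a.2

lemma mem_rowArcs {T : ℕ × ℕ → ℕ} {a : Fin μ.card × Fin μ.card} (h : a ∈ rowArcs μ T) :
    ∃ r c, (r, c) ∈ μ ∧ (r, c + 1) ∈ μ ∧ T (r, c) = a.1 ∧ T (r, c + 1) = a.2 := by
  simpa [rowArcs] using h

/-- The column reading tableau of shape `μ`. -/
def colTableau : ℕ × ℕ → ℕ := reading μ colKey

lemma reading_lt_iff {key : ℕ × ℕ → ℕ ×ₗ ℕ} {c d : ℕ × ℕ} (hc : c ∈ μ) :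
    reading μ key c < reading μ key d ↔ key c < key d := by
  constructor
  · intro h
    by_contra hcd
    refine absurd h (not_lt.2 (Finset.card_le_card ?_))
    intro e he
    rw [Finset.mem_filter] at he ⊢
    exact ⟨he.1, he.2.trans_le (not_lt.1 hcd)⟩
  · intro h
    refine Finset.card_lt_card (Finset.ssubset_iff_of_subset ?_ |>.2 ⟨c, ?_, ?_⟩)
    · intro e he
      rw [Finset.mem_filter] at he ⊢
      exact ⟨he.1, he.2.trans h⟩
    · rw [Finset.mem_filter]
      exact ⟨hc, h⟩
    · simp

lemma colTableau_lt_iff {r c r' c' : ℕ} (h : (r, c) ∈ μ) :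
    colTableau μ (r, c) < colTableau μ (r', c') ↔ c < c' ∨ c = c' ∧ r < r' := by
  rw [colTableau, reading_lt_iff μ h]
  simp [colKey, Prod.Lex.toLex_lt_toLex]

lemma colTableau_inj {r c r' c' : ℕ} (h : (r, c) ∈ μ) (h' : (r', c') ∈ μ)
    (he : colTableau μ (r, c) = colTableau μ (r', c')) : r = r' ∧ c = c' := by
  have h1 := colTableau_lt_iff μ (r' := r') (c' := c') h
  have h2 := colTableau_lt_iff μ (r' := r) (c' := c) h'
  omega

/-- `sp(T)` for the column reading tableau `T` of shape `μ`: its arcs join horizontally adjacent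
entries of `T`. -/
def sp : NonnestingSetPartition μ.card where
  arcs := rowArcs μ (colTableau μ)
  lt := by
    rintro ⟨a, b⟩ h
    obtain ⟨r, c, h1, h2, h3, h4⟩ := mem_rowArcs μ h
    have := (colTableau_lt_iff μ (r' := r) (c' := c + 1) h1).2 (by omega)
    simp only [Fin.lt_def] at *
    omega
  eq_iff := by
    rintro ⟨a, b⟩ h ⟨a', b'⟩ h'
    obtain ⟨r, c, h1, h2, h3, h4⟩ := mem_rowArcs μ h
    obtain ⟨r', c', h1', h2', h3', h4'⟩ := mem_rowArcs μ h'
    simp only at *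
    constructor
    · rintro rfl
      obtain ⟨rfl, rfl⟩ := colTableau_inj μ h1 h1' (h3.trans h3'.symm)
      exact Fin.ext (h4.symm.trans h4')
    · rintro rfl
      obtain ⟨rfl, hc⟩ := colTableau_inj μ h2 h2' (h4.trans h4'.symm)
      obtain rfl : c = c' := by omega
      exact Fin.ext (h3.symm.trans h3')
  nonnesting := by
    rintro ⟨a, b⟩ h ⟨a', b'⟩ h' ⟨hl, hr⟩
    obtain ⟨r, c, h1, h2, h3, h4⟩ := mem_rowArcs μ h
    obtain ⟨r', c', h1', h2', h3', h4'⟩ := mem_rowArcs μ h'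
    simp only [Fin.lt_def] at *
    rw [← h3, ← h3', colTableau_lt_iff μ h1] at hl
    rw [← h4, ← h4', colTableau_lt_iff μ h2'] at hr
    omega

variable (F : Type*) [Field F] [Finite F]

/-- `V_T` for the column reading tableau `T` of shape `μ`: all `u ∈ UT_n(F)` such that
`(u - 1)_{ij} ≠ 0` implies that there is an arc `i ⌢ k ∈ sp(T)` with `i < j < k` and `i` lies
strictly North of `j` in `T`. -/
def VT : Subgroup (UT μ.card F) :=
  patternSubgroup F (fun i j => (∃ k, (i, k) ∈ (sp μ).arcs ∧ i < j ∧ j < k) ∧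
    ∃ c ∈ μ, ∃ d ∈ μ, colTableau μ c = i ∧ colTableau μ d = j ∧ c.1 < d.1) (by
    rintro i j m hij hjm ⟨⟨k, hk, _, hjk⟩, ⟨r1, c1⟩, hc, ⟨r2, c2⟩, hd, e1, e2, hrow⟩
      ⟨⟨k', hk', _, hmk'⟩, ⟨r3, c3⟩, hc', ⟨r4, c4⟩, hd', e3, e4, hrow'⟩
    obtain ⟨r, c, h1, h2, h3, h4⟩ := mem_rowArcs μ hk
    obtain ⟨r', c', h1', h2', h3', h4'⟩ := mem_rowArcs μ hk'
    simp only [Fin.lt_def] at *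
    obtain ⟨rfl, rfl⟩ := colTableau_inj μ h1 hc (h3.trans e1.symm)
    obtain ⟨rfl, rfl⟩ := colTableau_inj μ hd hc' (e2.trans e3.symm)
    obtain ⟨rfl, rfl⟩ := colTableau_inj μ hd h1' (e2.trans h3'.symm)
    rw [← e1, ← e2, colTableau_lt_iff μ hc] at hij
    rw [← e2, ← e4, colTableau_lt_iff μ hd] at hjm
    rw [← e2, ← h4, colTableau_lt_iff μ hd] at hjk
    rw [← e4, ← h4', colTableau_lt_iff μ hd'] at hmk'
    refine ⟨⟨k, hk, ?_, ?_⟩, (r, c), hc, (r4, c4), hd', e1, e4, by simp only; omega⟩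
    · rw [← e1, ← e4, colTableau_lt_iff μ hc]; omega
    · rw [← e4, ← h4, colTableau_lt_iff μ hd']; omega)

/-- `U_T = V_T ⋉ U_{sp(T)}` for the column reading tableau `T` of shape `μ`: the subgroup generated
by `V_T` and the normal subgroup `U_{sp(T)}` of `UT_n(F)`, that is, their product. -/
def UTab : Subgroup (UT μ.card F) := VT μ F ⊔ setPartitionSubgroup F (sp μ)

/-! ### Generalized Gelfand–Graev characters -/

/-- The list of the columns `0, …, m-1` in the order in which `ctr` arranges them: numbering them
from `1`, first the even ones in decreasing order, then the odd ones in increasing order. -/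
def ctrOrder (m : ℕ) : List ℕ :=
  ((List.range m).filter fun c => (c + 1) % 2 = 0).reverse ++
    (List.range m).filter fun c => (c + 1) % 2 = 1

/-- The composition `ctr(μ')`: the column lengths of `μ`, rearranged by `ctr`. -/
def ctrComposition : List ℕ := (ctrOrder (μ.rowLen 0)).map μ.colLen

/-- `ggg(μ)`: the arcs join consecutive entries of the rows of `C_μ`. The tableau `C_μ` is obtained
by shifting the rows of the half-column reading tableau on the centred diagram, so the consecutive
entries of its rows are those of the latter. -/
def ggg : Finset (Fin μ.card × Fin μ.card) := rowArcs μ (reading μ (halfColKey μ))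

variable {F} in
/-- The generalized Gelfand–Graev character `Γ_μ = Ind_{U_{ctr(μ')}}^{GL_n(F)} γ_μ`, where
`γ_μ(u) = ∏_{i ⌢ j ∈ ggg(μ)} ϑ(u_{ij})`. -/
def gggCharacter (ϑ : AddChar F ℂ) : GL (Fin μ.card) F → ℂ :=
  ind ((compositionSubgroup F (ctrComposition μ)).map (UT μ.card F).subtype)
    (fun u => gam ϑ (ggg μ) u.1)

variable {F} in
/-- The function `|V_T|⁻¹ χ_nn^{sp(T)}` on `UT_n(F)`, for the column reading tableau `T`. -/
def scaledSupercharacter (ϑ : AddChar F ℂ) : UT μ.card F → ℂ :=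
  fun u => (Nat.card (VT μ F) : ℂ)⁻¹ * supercharacter ϑ (sp μ) u

end Tableaux

end

end GGG

namespace GGG

/-! All characters involved are induced from linear characters of pattern subgroups. They are
compared through sums, over all conjugates, of extensions by zero.

From `U_{sp(T)}` to `U_T`: the map `γ` is multiplicative on `U_T` because no arc splits into two
positions of its pattern. The sums for the two subgroups differ only at conjugates `w` in `U_T` with
a nonzero entry in the pattern of `V_T`. Let `(k, j)` be such an entry in the last possible row, and
`k ⌢ l` the arc from `k`. Conjugation by `1 + t E_{jl}` keeps the entries of `w` in that pattern and
multiplies `γ(w)` by `ϑ(-t w_{kj})`, so averaging over `t` kills the extra terms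
(`sum_conj_eq_zero`). What remains is the factor `|V_T|`. A trace computation shows that induction
from a linear character gives a character (`isCharacter_ind`).

From there to `GL_n`: let `J` be the nilpotent matrix that shifts the rows of the diagram. Then
`γ(u) = ϑ(tr J(u - 1))`, and its extension by zero from the pattern subgroup of `A` is the average
of `ϑ(tr W(g - 1))` over `W` in the coset `J + A^⊥`. The subgroup acts on this coset by conjugation,
and a slice through `J` is a free transversal: a grading gives injectivity and a count gives
surjectivity (`sliceAction_bijective`). Summation over `GL_n` absorbs the action, so the induced
function is a sum over the slice alone (`sum_conj_eq_sum_slice`). The slice depends only on the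
labelled diagram, not on `A`, and relabelling is conjugation by a permutation matrix. Hence any two
polarizations induce the same function (`Labelling.ind_eq_ind`).

It remains to check that the patterns of `U_T` and of `U_{ctr(μ')}` are polarizations. The count
holds because slice positions and incomparable pairs of either pattern are all equinumerous with
pairs of cells in a common column. For a single column of at least two cells there are no arcs and
`U_{sp(T)}` is all of `UT_n`, whereas `TabPattern` is empty; this is why that case is excluded. -/

/-! ### Induced functions and transitivity of induction. -/

open scoped Classical in
/-- The extension by zero of a function on a subgroup. -/
noncomputable def extendZero {G : Type*} [Group G] (H : Subgroup G) (f : H → ℂ) (g : G) : ℂ :=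
  if h : g ∈ H then f ⟨g, h⟩ else 0

lemma extendZero_of_mem {G : Type*} [Group G] {H : Subgroup G} {f : H → ℂ} {g : G} (h : g ∈ H) :
    extendZero H f g = f ⟨g, h⟩ := dif_pos h

lemma extendZero_of_notMem {G : Type*} [Group G] {H : Subgroup G} {f : H → ℂ} {g : G}
    (h : g ∉ H) : extendZero H f g = 0 := dif_neg h

lemma ind_apply {G : Type*} [Group G] [Fintype G] (H : Subgroup G) (f : H → ℂ) (g : G) :
    ind H f g = (Nat.card H : ℂ)⁻¹ * ∑ x : G, extendZero H f (x * g * x⁻¹) := by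
  rw [ind, finsum_eq_sum_of_fintype]
  rfl

/-- Induction is transitive. -/
lemma ind_ind {G : Type*} [Group G] [Finite G] (K : Subgroup G) (H : Subgroup K) (φ : G → ℂ) :
    ind K (ind H (fun u => φ u.1.1)) = ind (H.map K.subtype) (fun u => φ u.1) := by
  classical
  have := Fintype.ofFinite G
  funext g
  have key : ∀ x : G, extendZero K (ind H (fun u => φ u.1.1)) x =
      (Nat.card H : ℂ)⁻¹ * ∑ k : K, extendZero (H.map K.subtype) (fun u => φ u.1)
        ((k : G) * x * (k : G)⁻¹) := by
    intro x
    by_cases hx : x ∈ K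
    · rw [extendZero_of_mem hx, ind_apply]
      congr 1
      refine Finset.sum_congr rfl fun k _ => ?_
      by_cases hk : k * ⟨x, hx⟩ * k⁻¹ ∈ H
      · have hm : (k : G) * x * (k : G)⁻¹ ∈ H.map K.subtype := Subgroup.mem_map.2 ⟨_, hk, rfl⟩
        rw [extendZero_of_mem hk, extendZero_of_mem hm]
        rfl
      · rw [extendZero_of_notMem hk, extendZero_of_notMem]
        rintro ⟨y, hy, hyk⟩
        rw [show k * ⟨x, hx⟩ * k⁻¹ = y from Subtype.ext hyk.symm] at hk
        exact hk hy
    · rw [extendZero_of_notMem hx, Finset.sum_eq_zero, mul_zero]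
      intro k _
      refine extendZero_of_notMem ?_
      rintro ⟨y, hy, hyk⟩
      apply hx
      have : x = (k : G)⁻¹ * y * k := by
        rw [show (y : G) = k * x * (k : G)⁻¹ from hyk]; group
      rw [this]
      exact K.mul_mem (K.mul_mem (K.inv_mem k.2) y.2) k.2
  rw [ind_apply, ind_apply]
  simp_rw [key]
  rw [← Finset.mul_sum, Finset.sum_comm]
  -- Substituting `k * x` for `x` absorbs the inner conjugation, so the sum over `K` only
  -- contributes a factor `|K|`.
  have conj_sum : ∀ k : K, ∑ x : G, extendZero (H.map K.subtype) (fun u => φ u.1)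
      (k * (x * g * x⁻¹) * (k : G)⁻¹) =
      ∑ x : G, extendZero (H.map K.subtype) (fun u => φ u.1) (x * g * x⁻¹) := by
    intro k
    refine Fintype.sum_equiv (Equiv.mulLeft (k : G)) _ _ fun x => ?_
    simp only [Equiv.coe_mulLeft, mul_inv_rev, mul_assoc]
  simp_rw [conj_sum]
  rw [Finset.sum_const, Finset.card_univ, nsmul_eq_mul,
    Subgroup.card_map_of_injective K.subtype_injective, Nat.card_eq_fintype_card (α := K)]
  have : (Fintype.card K : ℂ) ≠ 0 := by exact_mod_cast Fintype.card_ne_zero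
  field_simp

/-! ### Induced representations and their traces. -/

section InducedRepresentation

variable {G : Type*} [Group G]

/-- Right translation of functions on a group. -/
def rightTranslation : Representation ℂ G (G → ℂ) where
  toFun g := LinearMap.funLeft ℂ ℂ (fun x => x * g)
  map_one' := by ext; simp
  map_mul' a b := by ext; simp [mul_assoc]

/-- The projection onto the functions that transform on the left by a linear character. -/
noncomputable def equivariantProjection (H : Subgroup G) [Fintype H] (γ : H →* ℂˣ) :
    (G → ℂ) →ₗ[ℂ] (G → ℂ) :=
  (Fintype.card H : ℂ)⁻¹ • ∑ h : H, (γ h : ℂ) • LinearMap.funLeft ℂ ℂ (fun x => (h : G)⁻¹ * x)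

lemma equivariantProjection_apply (H : Subgroup G) [Fintype H] (γ : H →* ℂˣ) (f : G → ℂ) (x : G) :
    equivariantProjection H γ f x =
      (Fintype.card H : ℂ)⁻¹ * ∑ h : H, (γ h : ℂ) * f ((h : G)⁻¹ * x) := by
  simp [equivariantProjection, LinearMap.funLeft_apply]

lemma equivariantProjection_mul (H : Subgroup G) [Fintype H] (γ : H →* ℂˣ) (f : G → ℂ) (h : H)
    (x : G) : equivariantProjection H γ f ((h : G)⁻¹ * x) =
      (γ h : ℂ)⁻¹ * equivariantProjection H γ f x := by
  rw [equivariantProjection_apply, equivariantProjection_apply, mul_left_comm]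
  congr 1
  rw [Finset.mul_sum]
  refine Fintype.sum_equiv (Equiv.mulLeft h) _ _ fun k => ?_
  simp [mul_assoc]

lemma equivariantProjection_idem (H : Subgroup G) [Fintype H] (γ : H →* ℂˣ) (f : G → ℂ) :
    equivariantProjection H γ (equivariantProjection H γ f) = equivariantProjection H γ f := by
  funext x
  rw [equivariantProjection_apply]
  simp_rw [equivariantProjection_mul]
  have : (Fintype.card H : ℂ) ≠ 0 := by exact_mod_cast Fintype.card_ne_zero
  simp [this]

lemma rightTranslation_equivariantProjection (H : Subgroup G) [Fintype H] (γ : H →* ℂˣ) (g : G)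
    (f : G → ℂ) : rightTranslation g (equivariantProjection H γ f) =
      equivariantProjection H γ (rightTranslation g f) := by
  funext x
  simp [rightTranslation, equivariantProjection_apply, LinearMap.funLeft_apply, mul_assoc]

lemma trace_pi_eq_sum {G : Type*} [Fintype G] (f : (G → ℂ) →ₗ[ℂ] (G → ℂ)) [DecidableEq G] :
    LinearMap.trace ℂ (G → ℂ) f = ∑ x, f (Pi.single x 1) x := by
  rw [LinearMap.trace_eq_matrix_trace ℂ (Pi.basisFun ℂ G), Matrix.trace]
  simp

/-- The diagonal entry at `x` is the projection of the delta function at `x`, evaluated at `x * g`.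
Only `h = x * g * x⁻¹` contributes to it, so the trace agrees with the induced function term by
term. -/
lemma trace_rightTranslation_comp [Fintype G] (H : Subgroup G) [Fintype H] (γ : H →* ℂˣ) (g : G) :
    LinearMap.trace ℂ (G → ℂ) (rightTranslation g ∘ₗ equivariantProjection H γ) =
      ind H (fun u => (γ u : ℂ)) g := by
  classical
  rw [trace_pi_eq_sum, ind_apply, Finset.mul_sum]
  refine Finset.sum_congr rfl fun x _ => ?_
  have : (rightTranslation g ∘ₗ equivariantProjection H γ) (Pi.single x 1) x =
      equivariantProjection H γ (Pi.single x 1) (x * g) := rfl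
  rw [this, equivariantProjection_apply, Nat.card_eq_fintype_card]
  congr 1
  by_cases hx : x * g * x⁻¹ ∈ H
  · rw [extendZero_of_mem hx, Finset.sum_eq_single ⟨x * g * x⁻¹, hx⟩]
    · simp [mul_assoc]
    · intro h _ hne
      rw [Pi.single_eq_of_ne, mul_zero]
      intro h'
      apply hne
      ext
      simp only
      nth_rw 2 [← h']
      group
    · simp
  · rw [extendZero_of_notMem hx]
    refine Finset.sum_eq_zero fun h _ => ?_
    rw [Pi.single_eq_of_ne, mul_zero]
    intro h'
    apply hx
    have : x * g * x⁻¹ = h := by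
      nth_rw 2 [← h']
      group
    rw [this]
    exact h.2

end InducedRepresentation

/-- A function induced from a linear character is the character of a representation. -/
lemma isCharacter_ind {G : Type*} [Group G] [Finite G] (H : Subgroup G) (γ : H →* ℂˣ) :
    IsCharacter (ind H (fun u => (γ u : ℂ))) := by
  classical
  have := Fintype.ofFinite G
  let E := equivariantProjection H γ
  let p : Submodule ℂ (G → ℂ) := LinearMap.range E
  let π : (G → ℂ) →ₗ[ℂ] p := E.rangeRestrict
  have hπ : ∀ f : p, π f = f := by
    rintro ⟨_, f, rfl⟩
    exact Subtype.ext (equivariantProjection_idem H γ f)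
  let b : p ≃ₗ[ℂ] (Fin (Module.finrank ℂ p) → ℂ) := (Module.finBasis ℂ p).equivFun
  let ρ : Representation ℂ G p :=
    { toFun := fun g => π ∘ₗ rightTranslation g ∘ₗ p.subtype
      map_one' := by
        ext1 f
        simp [hπ]
      map_mul' := by
        intro g h
        refine LinearMap.ext fun f => Subtype.ext ?_
        obtain ⟨_, f, rfl⟩ := f
        change E (rightTranslation (g * h) (E f)) =
          E (rightTranslation g (E (rightTranslation h (E f))))
        simp only [E, rightTranslation_equivariantProjection, equivariantProjection_idem, map_mul,
          Module.End.mul_apply] }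
  let ρ' : Representation ℂ G (Fin (Module.finrank ℂ p) → ℂ) :=
    { toFun := fun g => b.conj (ρ g)
      map_one' := by rw [map_one]; exact LinearEquiv.conj_id b
      map_mul' := by
        intro g h
        rw [map_mul]
        exact LinearEquiv.conj_comp b _ _ }
  refine ⟨_, ρ', fun g => ?_⟩
  rw [← trace_rightTranslation_comp]
  change LinearMap.trace ℂ _ (b.conj (ρ g)) = _
  rw [LinearMap.trace_conj']
  change LinearMap.trace ℂ _ (π ∘ₗ (rightTranslation g ∘ₗ p.subtype)) = _
  -- Cyclicity of the trace puts the inclusion next to `π`; their composite is the projection `E` on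
  -- all of `G → ℂ`.
  rw [LinearMap.trace_comp_comm']
  rfl

/-! ### Orders and products of pattern subgroups. -/

section Patterns

/-- The matrices supported on a relation are the functions on the pairs satisfying it. -/
def supportedMatrixEquiv {ι F : Type*} [Zero F] (A : ι → ι → Prop) [∀ i j, Decidable (A i j)] :
    {X : Matrix ι ι F // ∀ i j, X i j ≠ 0 → A i j} ≃ ({p : ι × ι // A p.1 p.2} → F) where
  toFun X p := X.1 p.1.1 p.1.2
  invFun f := ⟨fun i j => if h : A i j then f ⟨(i, j), h⟩ else 0, fun i j h => by
    by_contra hA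
    exact h (dif_neg hA)⟩
  left_inv X := by
    ext i j
    simp only [dite_eq_ite, ite_eq_left_iff]
    intro h
    by_contra hX
    exact h (X.2 i j (Ne.symm hX))
  right_inv f := by
    funext p
    exact dif_pos p.2

lemma card_supportedMatrix {ι F : Type*} [Finite ι] [Finite F] [Zero F] (A : ι → ι → Prop) :
    Nat.card {X : Matrix ι ι F // ∀ i j, X i j ≠ 0 → A i j} =
      Nat.card F ^ Nat.card {p : ι × ι // A p.1 p.2} := by
  classical
  rw [Nat.card_congr (supportedMatrixEquiv A), Nat.card_fun]

variable {n : ℕ}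

lemma det_one_add_of_strictUpper {F : Type*} [Field F] (X : Matrix (Fin n) (Fin n) F) (hX : ∀ i j, X i j ≠ 0 → i < j) :
    (1 + X).det = 1 := by
  have hzero : ∀ i j, j ≤ i → X i j = 0 := fun i j h => by
    by_contra hX'
    exact absurd (hX i j hX') (not_lt.2 h)
  rw [Matrix.det_of_isUpperTriangular]
  · exact Finset.prod_eq_one fun i _ => by simp [hzero i i le_rfl]
  · intro i j hij
    have hij : j < i := hij
    simp [hzero i j hij.le, Matrix.one_apply_ne hij.ne']

variable {F : Type*} [Field F] [Finite F]

/-- The unipotent matrix `1 + X` for a strictly upper triangular matrix `X`. -/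
noncomputable def oneAdd (X : Matrix (Fin n) (Fin n) F) (hX : ∀ i j, X i j ≠ 0 → i < j) :
    UT n F :=
  ⟨Matrix.GeneralLinearGroup.mkOfDetNeZero (1 + X)
    (by rw [det_one_add_of_strictUpper X hX]; exact one_ne_zero), by
    intro i j h
    apply hX
    have : (Matrix.GeneralLinearGroup.mkOfDetNeZero (1 + X) (by
      rw [det_one_add_of_strictUpper X hX]; exact one_ne_zero) : GL (Fin n) F).1 = 1 + X := rfl
    rwa [this, add_sub_cancel_left] at h⟩

lemma coe_oneAdd (X : Matrix (Fin n) (Fin n) F) (hX : ∀ i j, X i j ≠ 0 → i < j) :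
    (oneAdd X hX).1.1 = 1 + X := rfl

/-- The elements of a pattern subgroup correspond to matrices supported on the pattern. -/
noncomputable def patternSubgroupEquiv (P : Fin n → Fin n → Prop)
    (hP : ∀ i j k, i < j → j < k → P i j → P j k → P i k) :
    patternSubgroup F P hP ≃
      {X : Matrix (Fin n) (Fin n) F // ∀ i j, X i j ≠ 0 → i < j ∧ P i j} where
  toFun u := ⟨u.1.1.1 - 1, fun i j h => ⟨u.1.2 i j h, u.2 i j h⟩⟩
  invFun X := ⟨oneAdd X.1 fun i j h => (X.2 i j h).1, fun i j h =>
    (X.2 i j (by rwa [coe_oneAdd, add_sub_cancel_left] at h)).2⟩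
  left_inv u := by
    refine Subtype.ext (Subtype.ext (Units.ext ?_))
    rw [coe_oneAdd]
    exact add_sub_cancel _ _
  right_inv X := by
    refine Subtype.ext ?_
    simp only [coe_oneAdd, add_sub_cancel_left]

lemma card_patternSubgroup (P : Fin n → Fin n → Prop)
    (hP : ∀ i j k, i < j → j < k → P i j → P j k → P i k) :
    Nat.card (patternSubgroup F P hP) =
      Nat.card F ^ Nat.card {p : Fin n × Fin n // p.1 < p.2 ∧ P p.1 p.2} := by
  rw [Nat.card_congr (patternSubgroupEquiv P hP),
    card_supportedMatrix (fun i j : Fin n => i < j ∧ P i j)]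

/-- The product of two pattern subgroups with disjoint patterns is the pattern subgroup of the
union. -/
lemma patternSubgroup_sup (P Q : Fin n → Fin n → Prop)
    (hP : ∀ i j k, i < j → j < k → P i j → P j k → P i k)
    (hQ : ∀ i j k, i < j → j < k → Q i j → Q j k → Q i k)
    (hPQ : ∀ i j k, i < j → j < k → P i j ∨ Q i j → P j k ∨ Q j k → P i k ∨ Q i k)
    (hdisj : ∀ i j, i < j → P i j → ¬ Q i j) :
    patternSubgroup F P hP ⊔ patternSubgroup F Q hQ =
        patternSubgroup F (fun i j => P i j ∨ Q i j) hPQ ∧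
      Nat.card (patternSubgroup F (fun i j => P i j ∨ Q i j) hPQ) =
        Nat.card (patternSubgroup F P hP) * Nat.card (patternSubgroup F Q hQ) := by
  classical
  have hcard : Nat.card (patternSubgroup F (fun i j => P i j ∨ Q i j) hPQ) =
      Nat.card (patternSubgroup F P hP) * Nat.card (patternSubgroup F Q hQ) := by
    rw [card_patternSubgroup, card_patternSubgroup, card_patternSubgroup, ← pow_add]
    congr 1
    simp only [Nat.card_eq_fintype_card, Fintype.card_subtype]
    rw [← Finset.card_union_of_disjoint, ← Finset.filter_or]
    · congr 1
      ext p
      simp only [Finset.mem_filter]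
      tauto
    · rw [Finset.disjoint_filter]
      rintro p - ⟨h1, h2⟩ ⟨_, h3⟩
      exact hdisj _ _ h1 h2 h3
  -- The join lies in the pattern subgroup of the union, and the two have equal order: disjoint
  -- patterns make the subgroups meet trivially, so multiplication embeds their product set in the
  -- join.
  refine ⟨Subgroup.eq_of_le_of_card_ge (sup_le ?_ ?_) ?_, hcard⟩
  · exact fun u hu i j h => Or.inl (hu i j h)
  · exact fun u hu i j h => Or.inr (hu i j h)
  · have hd : Disjoint (patternSubgroup F P hP) (patternSubgroup F Q hQ) := by
      rw [Subgroup.disjoint_def]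
      intro u hu hu'
      refine Subtype.ext (Units.ext (sub_eq_zero.1 ?_))
      ext i j
      by_contra h
      exact hdisj i j (u.2 i j h) (hu i j h) (hu' i j h)
    rw [hcard, ← Nat.card_prod]
    refine Nat.card_le_card_of_injective (fun g => ⟨g.1.1 * g.2.1, ?_⟩) ?_
    · exact Subgroup.mul_mem_sup g.1.2 g.2.2
    · intro a b hab
      exact Subgroup.mul_injective_of_disjoint hd (congrArg Subtype.val hab)

end Patterns

/-! ### Linear characters given by arcs. -/

section PartialCharacters

variable {n : ℕ} {F : Type*} [Field F]

lemma addChar_sum {ι : Type*} (ϑ : AddChar F ℂ) (s : Finset ι) (f : ι → F) :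
    ϑ (∑ i ∈ s, f i) = ∏ i ∈ s, ϑ (f i) := by
  classical
  induction s using Finset.induction_on with
  | empty => simp
  | insert i s hi ih => rw [Finset.sum_insert hi, Finset.prod_insert hi, ϑ.map_add_eq_mul, ih]

/-- The values of `u ↦ ∏ ϑ(u_{ij})` in terms of `u - 1`. -/
lemma gam_eq_sum (ϑ : AddChar F ℂ) (η : Finset (Fin n × Fin n)) (hη : ∀ a ∈ η, a.1 < a.2)
    (u : GL (Fin n) F) : gam ϑ η u = ϑ (∑ a ∈ η, (u.1 - 1) a.1 a.2) := by
  rw [addChar_sum, gam]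
  refine Finset.prod_congr rfl fun a ha => ?_
  rw [Matrix.sub_apply, Matrix.one_apply_ne (hη a ha).ne, sub_zero]

/-- `gam` is multiplicative on matrices supported on a pattern in which no arc decomposes. -/
lemma gam_mul (ϑ : AddChar F ℂ) (η : Finset (Fin n × Fin n)) (hη : ∀ a ∈ η, a.1 < a.2)
    (R : Fin n → Fin n → Prop) (hR : ∀ a ∈ η, ∀ j, R a.1 j → ¬ R j a.2) (u v : GL (Fin n) F)
    (hu : ∀ i j, (u.1 - 1) i j ≠ 0 → R i j) (hv : ∀ i j, (v.1 - 1) i j ≠ 0 → R i j) :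
    gam ϑ η (u * v) = gam ϑ η u * gam ϑ η v := by
  rw [gam_eq_sum ϑ η hη, gam_eq_sum ϑ η hη, gam_eq_sum ϑ η hη, ← AddChar.map_add_eq_mul,
    ← Finset.sum_add_distrib]
  congr 1
  refine Finset.sum_congr rfl fun a ha => ?_
  have : (u * v : GL (Fin n) F).1 - 1 = (u.1 - 1) * (v.1 - 1) + (u.1 - 1) + (v.1 - 1) := by
    rw [Units.val_mul]; noncomm_ring
  rw [this, Matrix.add_apply, Matrix.add_apply, add_assoc, Matrix.mul_apply,
    Finset.sum_eq_zero, zero_add]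
  intro k _
  by_contra h
  exact hR a ha k (hu _ _ (left_ne_zero_of_mul h)) (hv _ _ (right_ne_zero_of_mul h))

lemma gam_ne_zero (ϑ : AddChar F ℂ) (η : Finset (Fin n × Fin n)) (u : GL (Fin n) F) :
    gam ϑ η u ≠ 0 :=
  Finset.prod_ne_zero_iff.2 fun _ _ => (ϑ.val_isUnit _).ne_zero

variable [Finite F]

/-- `gam` as a linear character. -/
noncomputable def gamHom (ϑ : AddChar F ℂ) (η : Finset (Fin n × Fin n))
    (hη : ∀ a ∈ η, a.1 < a.2) (R : Fin n → Fin n → Prop)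
    (hR : ∀ a ∈ η, ∀ j, R a.1 j → ¬ R j a.2) (H : Subgroup (UT n F))
    (hH : ∀ u ∈ H, ∀ i j, (u.1.1 - 1) i j ≠ 0 → R i j) : H →* ℂˣ where
  toFun u := Units.mk0 (gam ϑ η u.1.1) (gam_ne_zero ϑ η u.1.1)
  map_one' := by
    ext
    simp only [OneMemClass.coe_one, Units.val_mk0, Units.val_one]
    rw [gam_eq_sum ϑ η hη]
    simp
  map_mul' u v := by
    ext
    simp only [Units.val_mk0, Units.val_mul]
    exact gam_mul ϑ η hη R hR _ _ (hH _ u.2) (hH _ v.2)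

end PartialCharacters

/-! ### Elementary conjugations and character sums. -/

section Orthogonality

variable {n : ℕ} {F : Type*} [Field F]

/-- Conjugation by an elementary matrix. -/
lemma conj_one_add_single_sub_one (y w : GL (Fin n) F) (a b : Fin n) (hab : a ≠ b) (t : F)
    (hy : y.1 = 1 + Matrix.single a b t) (h0 : (w.1 - 1) b a = 0) (i j : Fin n) :
    ((y * w * y⁻¹ : GL (Fin n) F).1 - 1) i j =
      (w.1 - 1) i j + (if i = a then t * (w.1 - 1) b j else 0) -
        (if j = b then t * (w.1 - 1) i a else 0) := by
  have hE : Matrix.single a b t * Matrix.single a b t = (0 : Matrix (Fin n) (Fin n) F) :=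
    by apply Matrix.single_mul_single_of_ne; exact hab.symm
  have hyi : (y⁻¹ : GL (Fin n) F).1 = 1 - Matrix.single a b t := by
    have : y.1 * (1 - Matrix.single a b t) = 1 := by
      rw [hy, add_mul, one_mul, mul_sub, mul_one, hE, sub_zero, sub_add_cancel]
    calc (y⁻¹ : GL (Fin n) F).1 = (y⁻¹ : GL (Fin n) F).1 * (y.1 * (1 - Matrix.single a b t)) := by
          rw [this, mul_one]
      _ = 1 - Matrix.single a b t := by rw [← mul_assoc, ← Units.val_mul]; simp
  have hX : (y * w * y⁻¹ : GL (Fin n) F).1 - 1 = (w.1 - 1) + Matrix.single a b t * (w.1 - 1) -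
      (w.1 - 1) * Matrix.single a b t -
        Matrix.single a b t * (w.1 - 1) * Matrix.single a b t := by
    have h1 : (y * w * y⁻¹ : GL (Fin n) F).1 = y.1 * w.1 * (1 - Matrix.single a b t) := by
      rw [Units.val_mul, Units.val_mul, hyi]
    rw [h1, hy]
    have h2 : (1 + Matrix.single a b t) * w.1 * (1 - Matrix.single a b t) - 1 =
      (w.1 - 1) + Matrix.single a b t * (w.1 - 1) - (w.1 - 1) * Matrix.single a b t -
        Matrix.single a b t * (w.1 - 1) * Matrix.single a b t -
        Matrix.single a b t * Matrix.single a b t := by noncomm_ring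
    rw [h2, hE, sub_zero]
  -- The term quadratic in `t` is a multiple of the entry `(b, a)`, which vanishes by `h0`.
  rw [hX, Matrix.single_mul_mul_single, h0, mul_zero, zero_mul, Matrix.single_zero, sub_zero,
    Matrix.sub_apply, Matrix.add_apply]
  congr 1
  · congr 1
    split_ifs with h
    · rw [h, Matrix.single_mul_apply_same]
    · exact Matrix.single_mul_apply_of_ne t a b i j h _
  · split_ifs with h
    · rw [h, Matrix.mul_single_apply_same, mul_comm]
    · exact Matrix.mul_single_apply_of_ne t a b i j h _

/-- A sum vanishes if permutations multiply its terms by nontrivial characters. -/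
lemma sum_eq_zero_of_permute {α : Type*} [Fintype α] [Fintype F] (ϑ : AddChar F ℂ)
    (hϑ : ϑ ≠ 1) (f : α → ℂ) (y : F → Equiv.Perm α) (m : α → F) (hm : ∀ x, f x ≠ 0 → m x ≠ 0)
    (hy : ∀ t x, f x ≠ 0 → f (y t x) = f x * ϑ (-(t * m x)))
    (hy0 : ∀ t x, f x = 0 → f (y t x) = 0) : ∑ x, f x = 0 := by
  classical
  -- Average over `t`: for fixed `x` the inner sum becomes the full sum of a nontrivial additive
  -- character.
  have h1 : (Fintype.card F : ℂ) * ∑ x, f x = ∑ t : F, ∑ x, f (y t x) := by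
    have : ∀ t : F, ∑ x, f (y t x) = ∑ x, f x := fun t => Equiv.sum_comp (y t) f
    simp_rw [this]
    simp
  have h2 : ∑ t : F, ∑ x, f (y t x) = 0 := by
    rw [Finset.sum_comm]
    refine Finset.sum_eq_zero fun x _ => ?_
    by_cases hx : f x = 0
    · exact Finset.sum_eq_zero fun t _ => hy0 t x hx
    · simp_rw [hy _ x hx]
      rw [← Finset.mul_sum]
      have h3 : ∑ t : F, ϑ (-(t * m x)) = 0 := by
        have h := AddChar.sum_mulShift (-m x) (AddChar.IsPrimitive.of_ne_one hϑ)
        rw [if_neg (neg_ne_zero.2 (hm x hx)), Nat.cast_zero] at h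
        simpa only [mul_neg] using h
      rw [h3, mul_zero]
  have hF : (Fintype.card F : ℂ) ≠ 0 := by exact_mod_cast Fintype.card_ne_zero
  rw [h2] at h1
  exact (mul_eq_zero.1 h1).resolve_left hF

end Orthogonality

/-! ### Extending the character of a nonnesting set partition. -/

section Supercharacters

variable {n : ℕ} (η : NonnestingSetPartition n) (V : Fin n → Fin n → Prop)

/-- The pattern of `U_η`: no arc of `η` other than `j ⌢ k` covers `j, k`. -/
def Uncovered (j k : Fin n) : Prop := ¬ ∃ a ∈ η.arcs, a ≠ (j, k) ∧ a.1 ≤ j ∧ k ≤ a.2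

variable {η}

lemma Uncovered.right {i j k : Fin n} (h : Uncovered η i j) (hjk : j < k) : Uncovered η i k := by
  rintro ⟨a, ha, -, h1, h2⟩
  refine h ⟨a, ha, ?_, h1, hjk.le.trans h2⟩
  rintro rfl
  exact absurd h2 (not_le.2 hjk)

lemma Uncovered.left {i j k : Fin n} (h : Uncovered η j k) (hij : i < j) : Uncovered η i k := by
  rintro ⟨a, ha, -, h1, h2⟩
  refine h ⟨a, ha, ?_, h1.trans hij.le, h2⟩
  rintro rfl
  exact absurd h1 (not_le.2 hij)

/-- An arc covering `i, l` cannot start before `k`: it would strictly nest `k ⌢ l` or share its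
right end. So it is `k ⌢ l` itself and `i = k`, the excluded arc. -/
lemma uncovered_of_le {i k l : Fin n} (h : (k, l) ∈ η.arcs) (hik : i ≤ k) : Uncovered η i l := by
  rintro ⟨a, ha, hne, h1, h2⟩
  have h3 : ¬ a.1 < k := fun hlt => by
    have h4 := η.nonnesting a ha (k, l) h
    have h5 : a.2 = l := le_antisymm (not_lt.1 fun h' => h4 ⟨hlt, h'⟩) h2
    exact hlt.ne ((η.eq_iff a ha (k, l) h).2 h5)
  have h6 : a.1 = k := le_antisymm (h1.trans hik) (not_lt.1 h3)
  have h7 : a.2 = l := (η.eq_iff a ha (k, l) h).1 h6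
  have h8 : i = k := le_antisymm hik (h6 ▸ h1)
  exact hne (Prod.ext (h6.trans h8.symm) h7)

lemma not_uncovered_of_arc {i j k : Fin n} (h : (i, k) ∈ η.arcs) (hjk : j < k) :
    ¬ Uncovered η i j := fun hu =>
  hu ⟨(i, k), h, fun he => hjk.ne (congrArg Prod.snd he).symm, le_rfl, hjk.le⟩

lemma not_uncovered_of_arc' {i j k : Fin n} (h : (i, k) ∈ η.arcs) (hij : i < j) :
    ¬ Uncovered η j k := fun hu =>
  hu ⟨(i, k), h, fun he => hij.ne (congrArg Prod.fst he), hij.le, le_rfl⟩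

variable (η)

/-- The hypotheses on the pattern `V`. -/
structure IsArmPattern : Prop where
  trans : ∀ i j k, i < j → j < k → V i j → V j k → V i k
  arc : ∀ i j, V i j → ∃ k, (i, k) ∈ η.arcs ∧ i < j ∧ j < k
  not_arc : ∀ i j k, (i, k) ∈ η.arcs → V i j → ¬ V j k

variable {η V}

namespace IsArmPattern

lemma disjoint (h : IsArmPattern η V) (i j : Fin n) (hV : V i j) : ¬ Uncovered η i j := by
  obtain ⟨k, hk, _, hjk⟩ := h.arc i j hV
  exact not_uncovered_of_arc hk hjk

lemma sup_trans (h : IsArmPattern η V) (i j k : Fin n) (hij : i < j) (hjk : j < k)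
    (h1 : V i j ∨ Uncovered η i j) (h2 : V j k ∨ Uncovered η j k) :
    V i k ∨ Uncovered η i k := by
  rcases h1 with h1 | h1
  · rcases h2 with h2 | h2
    · exact Or.inl (h.trans i j k hij hjk h1 h2)
    · exact Or.inr (h2.left hij)
  · exact Or.inr (h1.right hjk)

/-- This makes `gam` multiplicative on the larger group. Both parts of a split arc are covered by
that arc, so they could only lie in `V`, which `not_arc` forbids. -/
lemma not_decomposable (h : IsArmPattern η V) (a : Fin n × Fin n) (ha : a ∈ η.arcs) (j : Fin n)
    (h1 : a.1 < j ∧ (V a.1 j ∨ Uncovered η a.1 j)) :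
    ¬ (j < a.2 ∧ (V j a.2 ∨ Uncovered η j a.2)) := by
  rintro ⟨h2, h3⟩
  rcases h1.2 with h4 | h4
  · rcases h3 with h3 | h3
    · exact h.not_arc a.1 j a.2 ha h4 h3
    · exact not_uncovered_of_arc' (i := a.1) ha h1.1 h3
  · exact not_uncovered_of_arc (k := a.2) ha h2 h4

variable {F : Type*} [Field F]

/-- `w` is unipotent and supported on `V` and the pattern of `U_η`. -/
def Mem (V : Fin n → Fin n → Prop) (η : NonnestingSetPartition n) (w : GL (Fin n) F) : Prop :=
  ∀ i j, (w.1 - 1) i j ≠ 0 → i < j ∧ (V i j ∨ Uncovered η i j)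

/-- The position `p` supports a nonzero entry of `w` in `V`, in the last row with such an entry. -/
def IsPivot (V : Fin n → Fin n → Prop) (w : GL (Fin n) F) (p : Fin n × Fin n) : Prop :=
  V p.1 p.2 ∧ (w.1 - 1) p.1 p.2 ≠ 0 ∧ ∀ i j, V i j → (w.1 - 1) i j ≠ 0 → i ≤ p.1

lemma exists_isPivot {w : GL (Fin n) F} (h : ∃ i j, V i j ∧ (w.1 - 1) i j ≠ 0) :
    ∃ p, IsPivot V w p := by
  classical
  obtain ⟨i, j, hij⟩ := h
  let s : Finset (Fin n × Fin n) := Finset.univ.filter fun p => V p.1 p.2 ∧ (w.1 - 1) p.1 p.2 ≠ 0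
  obtain ⟨p, hp, hmax⟩ := s.exists_max_image (fun p => p.1) ⟨(i, j), by
    simp only [s, Finset.mem_filter, Finset.mem_univ, true_and]
    exact hij⟩
  have hp' : V p.1 p.2 ∧ (w.1 - 1) p.1 p.2 ≠ 0 := by simpa only [s, Finset.mem_filter,
    Finset.mem_univ, true_and] using hp
  refine ⟨p, hp'.1, hp'.2, fun i j hV hw => hmax (i, j) ?_⟩
  simp only [s, Finset.mem_filter, Finset.mem_univ, true_and]
  exact ⟨hV, hw⟩

/-- The effect of conjugation by the elementary matrix opposite to a pivot. -/
lemma conj_pivot (h : IsArmPattern η V) {w y : GL (Fin n) F} (hw : Mem V η w) {k j l : Fin n}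
    (hp : IsPivot V w (k, j)) (hkl : (k, l) ∈ η.arcs) (hjl : j < l) (t : F)
    (hy : y.1 = 1 + Matrix.single j l t) :
    Mem V η (y * w * y⁻¹) ∧
      (∀ a b, V a b → ((y * w * y⁻¹ : GL (Fin n) F).1 - 1) a b = (w.1 - 1) a b) ∧
      ∑ a ∈ η.arcs, ((y * w * y⁻¹ : GL (Fin n) F).1 - 1) a.1 a.2 =
        ∑ a ∈ η.arcs, (w.1 - 1) a.1 a.2 - t * (w.1 - 1) k j := by
  have hlow : ∀ a b, b ≤ a → (w.1 - 1) a b = 0 := fun a b hab => by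
    by_contra h'
    exact absurd (hw a b h').1 (not_lt.2 hab)
  have hconj := conj_one_add_single_sub_one y w j l hjl.ne t hy (hlow l j hjl.le)
  have hkl' : k < l := η.lt _ hkl
  -- Conjugation adds a multiple of row `l` to row `j`. Row `l` is below the pivot row, so it has no
  -- entries in `V`.
  have hrow : ∀ b, (w.1 - 1) l b ≠ 0 → l < b ∧ Uncovered η l b := by
    intro b hb
    refine ⟨(hw l b hb).1, (hw l b hb).2.resolve_left fun hV => ?_⟩
    exact absurd (hp.2.2 l b hV hb) (not_le.2 hkl')
  -- Conjugation subtracts a multiple of column `j` from column `l`. Entries of column `j` in `V`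
  -- have row at most `k`, so they land in uncovered positions.
  have hcol : ∀ a, (w.1 - 1) a j ≠ 0 → a < j ∧ Uncovered η a l := by
    intro a ha
    refine ⟨(hw a j ha).1, ?_⟩
    rcases (hw a j ha).2 with hV | hU
    · exact uncovered_of_le hkl (hp.2.2 a j hV ha)
    · exact hU.right hjl
  refine ⟨?_, ?_, ?_⟩
  · intro a b hab
    rw [hconj] at hab
    by_cases h0 : (w.1 - 1) a b = 0
    · by_cases h1 : a = j ∧ (w.1 - 1) l b ≠ 0
      · obtain ⟨rfl, h1⟩ := h1
        exact ⟨hjl.trans (hrow b h1).1, Or.inr ((hrow b h1).2.left hjl)⟩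
      · by_cases h2 : b = l ∧ (w.1 - 1) a j ≠ 0
        · obtain ⟨rfl, h2⟩ := h2
          exact ⟨(hcol a h2).1.trans hjl, Or.inr (hcol a h2).2⟩
        · exfalso
          apply hab
          have h3 : (if a = j then t * (w.1 - 1) l b else 0) = 0 := by
            split_ifs with h'
            · rw [not_and, not_not] at h1; rw [h1 h', mul_zero]
            · rfl
          have h4 : (if b = l then t * (w.1 - 1) a j else 0) = 0 := by
            split_ifs with h'
            · rw [not_and, not_not] at h2; rw [h2 h', mul_zero]
            · rfl
          rw [h0, h3, h4, add_zero, sub_zero]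
    · exact hw a b h0
  · intro a b hV
    rw [hconj]
    have h3 : (if a = j then t * (w.1 - 1) l b else 0) = 0 := by
      split_ifs with h'
      · by_contra hne
        subst h'
        exact h.disjoint a b hV ((hrow b (right_ne_zero_of_mul hne)).2.left hjl)
      · rfl
    have h4 : (if b = l then t * (w.1 - 1) a j else 0) = 0 := by
      split_ifs with h'
      · by_contra hne
        subst h'
        exact h.disjoint a b hV (hcol a (right_ne_zero_of_mul hne)).2
      · rfl
    rw [h3, h4, add_zero, sub_zero]
  · have h1 : ∀ a ∈ η.arcs, ((y * w * y⁻¹ : GL (Fin n) F).1 - 1) a.1 a.2 =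
        (w.1 - 1) a.1 a.2 - if a = (k, l) then t * (w.1 - 1) k j else 0 := by
      rintro ⟨a, b⟩ hab
      rw [hconj]
      have h3 : (if a = j then t * (w.1 - 1) l b else 0) = 0 := by
        split_ifs with h'
        · by_contra hne
          subst h'
          exact not_uncovered_of_arc' hab hjl (hrow b (right_ne_zero_of_mul hne)).2
        · rfl
      simp only [h3, add_zero]
      congr 1
      by_cases hb : b = l
      · have ha : a = k := (η.eq_iff _ hab _ hkl).2 hb
        rw [if_pos hb, if_pos (by rw [ha, hb]), ha]
      · rw [if_neg hb, if_neg fun he => hb (congrArg Prod.snd he)]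
    rw [Finset.sum_congr rfl h1, Finset.sum_sub_distrib, Finset.sum_ite_eq' η.arcs (k, l),
      if_pos hkl]

open scoped Classical in
/-- An element satisfying `P`, if there is one. -/
noncomputable def chooseOption {α : Type*} (P : α → Prop) : Option α :=
  if h : ∃ a, P a then some h.choose else none

lemma of_chooseOption_eq_some {α : Type*} {P : α → Prop} {a : α}
    (h : chooseOption P = some a) : P a := by
  unfold chooseOption at h
  split_ifs at h with h'
  rw [← Option.some.inj h]
  exact h'.choose_spec

lemma chooseOption_ne_none {α : Type*} {P : α → Prop} (h : ∃ a, P a) :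
    chooseOption P ≠ none := by
  unfold chooseOption
  rw [dif_pos h]
  exact Option.some_ne_none _

-- These are the terms by which the inductions from the two subgroups differ; they cancel within
-- families of conjugates sharing a pivot.
open scoped Classical in
lemma sum_conj_eq_zero [Finite F] (h : IsArmPattern η V) (ϑ : AddChar F ℂ) (hϑ : ϑ ≠ 1)
    [Fintype (UT n F)] (u : UT n F) :
    ∑ x : UT n F, (if Mem V η (x * u * x⁻¹).1 ∧ ∃ i j, V i j ∧ ((x * u * x⁻¹).1.1 - 1) i j ≠ 0 then
      gam ϑ η.arcs (x * u * x⁻¹).1 else 0) = 0 := by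
  have := Fintype.ofFinite F
  -- The last row may contain several pivots. One is fixed as a function of the predicate alone, so
  -- that the elementary conjugations preserve each fibre.
  rw [← Finset.sum_fiberwise Finset.univ (fun x => chooseOption (IsPivot V (x * u * x⁻¹).1))]
  refine Finset.sum_eq_zero fun o _ => ?_
  rw [Finset.sum_filter]
  rcases o with _ | ⟨k, j⟩
  · refine Finset.sum_eq_zero fun x _ => ?_
    split_ifs with h1 h2
    · exact absurd h1 (chooseOption_ne_none (exists_isPivot h2.2))
    · rfl
    · rfl
  by_cases hV : V k j
  swap
  · refine Finset.sum_eq_zero fun x _ => ?_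
    rw [if_neg]
    exact fun he => hV (of_chooseOption_eq_some he).1
  obtain ⟨l, hkl, hkj, hjl⟩ := h.arc k j hV
  have hs : ∀ t : F, ∀ a b, Matrix.single j l t a b ≠ 0 → a < b := by
    intro t a b hab
    by_contra hlt
    apply hab
    apply Matrix.single_apply_of_ne
    rintro ⟨rfl, rfl⟩
    exact hlt hjl
  let y : F → UT n F := fun t => oneAdd (Matrix.single j l t) (hs t)
  have hyinv : ∀ t, (y t)⁻¹ = y (-t) := by
    intro t
    rw [inv_eq_iff_mul_eq_one]
    refine Subtype.ext (Units.ext ?_)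
    change (1 + Matrix.single j l t) * (1 + Matrix.single j l (-t)) = 1
    have hE : Matrix.single j l t * Matrix.single j l (-t) = (0 : Matrix (Fin n) (Fin n) F) := by
      apply Matrix.single_mul_single_of_ne; exact hjl.ne'
    rw [add_mul, one_mul, mul_add, mul_one, hE, add_zero, add_assoc, ← Matrix.single_add]
    simp
  have hpres : ∀ (t : F) (x : UT n F), Mem V η (x * u * x⁻¹).1 →
      chooseOption (IsPivot V (x * u * x⁻¹).1) = some (k, j) →
      Mem V η (y t * x * u * (y t * x)⁻¹).1 ∧
      chooseOption (IsPivot V (y t * x * u * (y t * x)⁻¹).1) = some (k, j) ∧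
      (∀ a b, V a b → ((y t * x * u * (y t * x)⁻¹).1.1 - 1) a b =
        ((x * u * x⁻¹).1.1 - 1) a b) ∧
      gam ϑ η.arcs (y t * x * u * (y t * x)⁻¹).1 =
        gam ϑ η.arcs (x * u * x⁻¹).1 * ϑ (-(t * ((x * u * x⁻¹).1.1 - 1) k j)) := by
    intro t x hx hc
    have hyx : (y t * x * u * (y t * x)⁻¹).1 = (y t).1 * (x * u * x⁻¹).1 * (y t).1⁻¹ := by
      rw [← Subgroup.coe_inv, ← Subgroup.coe_mul, ← Subgroup.coe_mul]
      congr 1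
      group
    obtain ⟨h1, h2, h3⟩ := h.conj_pivot hx (of_chooseOption_eq_some hc) hkl hjl t
      (y := (y t).1) rfl
    rw [hyx]
    refine ⟨h1, ?_, h2, ?_⟩
    -- The pivot predicate sees only entries in `V`, which the conjugation leaves alone; hence the
    -- chosen pivot is the same.
    · rw [← hc]
      congr 1
      funext p
      refine propext (and_congr_right fun hVp => and_congr (by rw [h2 _ _ hVp]) ?_)
      refine forall_congr' fun a => forall_congr' fun b => forall_congr' fun hVab => ?_
      rw [h2 _ _ hVab]
    · rw [gam_eq_sum ϑ _ η.lt, gam_eq_sum ϑ _ η.lt, h3, sub_eq_add_neg, AddChar.map_add_eq_mul]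
  let f : UT n F → ℂ := fun x =>
    if chooseOption (IsPivot V (x * u * x⁻¹).1) = some (k, j) then
      if Mem V η (x * u * x⁻¹).1 ∧ ∃ i j, V i j ∧ ((x * u * x⁻¹).1.1 - 1) i j ≠ 0 then
        gam ϑ η.arcs (x * u * x⁻¹).1 else 0
    else 0
  have hf : ∀ t x, f x ≠ 0 → f (y t * x) = f x * ϑ (-(t * ((x * u * x⁻¹).1.1 - 1) k j)) := by
    intro t x hx
    simp only [f] at hx ⊢
    have hc : chooseOption (IsPivot V (x * u * x⁻¹).1) = some (k, j) := by
      by_contra hc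
      exact hx (if_neg hc)
    rw [if_pos hc] at hx ⊢
    have hm : Mem V η (x * u * x⁻¹).1 := by
      by_contra hm
      exact hx (if_neg fun h' => hm h'.1)
    have hp := of_chooseOption_eq_some hc
    obtain ⟨h1, h2, h3, h4⟩ := hpres t x hm hc
    rw [if_pos h2, if_pos ⟨h1, k, j, hV, by rw [h3 _ _ hV]; exact hp.2.1⟩,
      if_pos ⟨hm, k, j, hV, hp.2.1⟩, h4]
  have hf0 : ∀ t x, f x = 0 → f (y t * x) = 0 := by
    intro t x hx
    simp only [f] at hx ⊢
    by_contra hne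
    apply hne
    have hc : chooseOption (IsPivot V (y t * x * u * (y t * x)⁻¹).1) = some (k, j) := by
      by_contra hc
      exact hne (if_neg hc)
    rw [if_pos hc] at hne
    have hm : Mem V η (y t * x * u * (y t * x)⁻¹).1 := by
      by_contra hm
      exact hne (if_neg fun h' => hm h'.1)
    -- Undoing the conjugation shows that it cannot create a nonzero term from a zero one.
    obtain ⟨h1, h2, -, -⟩ := hpres (-t) (y t * x) hm hc
    rw [← hyinv, inv_mul_cancel_left] at h1 h2
    have hp := of_chooseOption_eq_some h2
    rw [if_pos h2, if_pos ⟨h1, k, j, hV, hp.2.1⟩] at hx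
    exact absurd hx (gam_ne_zero _ _ _)

  refine sum_eq_zero_of_permute ϑ hϑ f (fun t => Equiv.mulLeft (y t))
    (fun x => ((x * u * x⁻¹).1.1 - 1) k j) ?_ hf hf0
  · intro x hx
    by_cases hc : chooseOption (IsPivot V (x * u * x⁻¹).1) = some (k, j)
    · exact (of_chooseOption_eq_some hc).2.1
    · exact absurd (if_neg hc) hx

/-- Inducing `γ_η` from `U_η` gives a multiple of what is induced from its extension. -/
lemma ind_eq [Finite F] (h : IsArmPattern η V) (ϑ : AddChar F ℂ) (hϑ : ϑ ≠ 1)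
    (H : Subgroup (UT n F)) (hH : ∀ u : UT n F, u ∈ H ↔ Mem V η u.1) (c : ℕ)
    (hc : Nat.card H = c * Nat.card (setPartitionSubgroup F η)) (u : UT n F) :
    (c : ℂ)⁻¹ * supercharacter ϑ η u = ind H (fun u => gam ϑ η.arcs u.1.1) u := by
  classical
  have := Fintype.ofFinite (UT n F)
  rw [supercharacter, ind_apply, ind_apply, hc, Nat.cast_mul, mul_inv, mul_assoc]
  congr 2
  -- After matching the normalizing factors, the difference of the sums is supported on the
  -- conjugates in `H` outside `U_η`.
  rw [← sub_eq_zero, ← Finset.sum_sub_distrib, ← neg_eq_zero, ← Finset.sum_neg_distrib,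
    ← h.sum_conj_eq_zero ϑ hϑ u]
  refine Finset.sum_congr rfl fun x _ => ?_
  rw [neg_sub]
  generalize x * u * x⁻¹ = w
  by_cases hw : Mem V η w.1
  · rw [extendZero_of_mem ((hH w).2 hw)]
    by_cases hV : ∃ i j, V i j ∧ (w.1.1 - 1) i j ≠ 0
    · rw [if_pos ⟨hw, hV⟩, extendZero_of_notMem, sub_zero]
      obtain ⟨i, j, hV, hne⟩ := hV
      exact fun hmem => h.disjoint i j hV (hmem i j hne)
    · rw [if_neg fun h' => hV h'.2, extendZero_of_mem, sub_self]
      exact fun i j hne => (hw i j hne).2.resolve_left fun h' => hV ⟨i, j, h', hne⟩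
  · rw [if_neg fun h' => hw h'.1, extendZero_of_notMem (mt (hH w).1 hw), extendZero_of_notMem,
      sub_zero]
    exact fun hmem => hw fun i j hne => ⟨w.2 i j hne, Or.inr (hmem i j hne)⟩

end IsArmPattern

end Supercharacters

/-! ### Polarizations and the slice through the shift matrix. -/

section Slices

variable {ι : Type*} (row col : ι → ℕ)

/-- `y` is the right neighbour of `x`. -/
def Next (x y : ι) : Prop := row y = row x ∧ col y = col x + 1

/-- The positions `(y, x)` at which the elements of the slice are arbitrary: `x` is the last entry
of its row, and the column of `y` is not to the right of that of `x`. -/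
def SlicePos (y x : ι) : Prop := (¬ ∃ z, Next row col x z) ∧ col y ≤ col x

open scoped Classical in
/-- The nilpotent matrix that shifts the rows by one step to the right. -/
noncomputable def shiftMatrix (F : Type*) [Field F] : Matrix ι ι F :=
  Matrix.of fun y x => if Next row col x y then 1 else 0

/-- The entries are determined by their rows and columns, and the rows begin in column `0`. -/
structure IsFilling : Prop where
  inj : ∀ x y, row x = row y → col x = col y → x = y
  pred : ∀ x, col x ≠ 0 → ∃ y, Next row col y x

/-- The patterns `A` for which `X ↦ tr (J X)`, with `J` the shift matrix, defines a linear character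
of the pattern subgroup of `A`, and the coset `J + A^⊥` is a union of orbits of this group, each
meeting the slice in one element. -/
structure IsPolarization (A : ι → ι → Prop) : Prop where
  trans : ∀ x y z, A x y → A y z → A x z
  not_next : ∀ x y z, Next row col x z → A x y → ¬ A y z
  exists_next : ∀ y x, A y x → col x ≤ col y → ∃ z, Next row col y z
  grading : ∃ (h : ι → ℤ) (N : ℤ), (∀ x y, Next row col x y → h y = h x + N) ∧
    (∀ x y, A x y → h x < h y) ∧ ∀ x y, ¬ A x y → h y - h x < N
  card : 2 * Nat.card {p : ι × ι // A p.1 p.2} +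
    Nat.card {p : ι × ι // SlicePos row col p.1 p.2} = Nat.card ι ^ 2

variable {row col}

namespace IsFilling

variable (hf : IsFilling row col)
include hf

lemma next_left_unique {x x' y : ι} (h : Next row col x y) (h' : Next row col x' y) : x = x' :=
  hf.inj _ _ (h.1.symm.trans h'.1) (Nat.succ_injective (h.2.symm.trans h'.2))

lemma next_right_unique {x y y' : ι} (h : Next row col x y) (h' : Next row col x y') : y = y' :=
  hf.inj _ _ (h.1.trans h'.1.symm) (h.2.trans h'.2.symm)

variable {F : Type*} [Field F] [Fintype ι] (X : Matrix ι ι F)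

lemma shiftMatrix_mul_apply {y' y : ι} (h : Next row col y' y) (x : ι) :
    (shiftMatrix row col F * X) y x = X y' x := by
  rw [Matrix.mul_apply, Finset.sum_eq_single y']
  · simp [shiftMatrix, h]
  · intro z _ hz
    have : ¬ Next row col z y := fun h' => hz (hf.next_left_unique h' h)
    simp [shiftMatrix, this]
  · simp

lemma mul_shiftMatrix_apply {x x' : ι} (h : Next row col x x') (y : ι) :
    (X * shiftMatrix row col F) y x = X y x' := by
  rw [Matrix.mul_apply, Finset.sum_eq_single x']
  · simp [shiftMatrix, h]
  · intro z _ hz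
    have : ¬ Next row col x z := fun h' => hz (hf.next_right_unique h' h)
    simp [shiftMatrix, this]
  · simp

omit hf in
lemma shiftMatrix_mul_apply_eq_zero {y : ι} (h : ∀ y', ¬ Next row col y' y) (x : ι) :
    (shiftMatrix row col F * X) y x = 0 := by
  rw [Matrix.mul_apply]
  exact Finset.sum_eq_zero fun z _ => by simp [shiftMatrix, h z]

omit hf in
lemma mul_shiftMatrix_apply_eq_zero {x : ι} (h : ∀ x', ¬ Next row col x x') (y : ι) :
    (X * shiftMatrix row col F) y x = 0 := by
  rw [Matrix.mul_apply]
  exact Finset.sum_eq_zero fun z _ => by simp [shiftMatrix, h z]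

end IsFilling

namespace IsPolarization

variable {A : ι → ι → Prop} (hf : IsFilling row col) (hA : IsPolarization row col A)
variable {F : Type*} [Field F] [Fintype ι]

include hf hA

/-- A homogeneous matrix supported on `A` whose commutator with the shift matrix is supported on
the slice vanishes. -/
lemma eq_zero_of_commutator (h : ι → ℤ) (N d : ℤ) (hN : ∀ x y, Next row col x y → h y = h x + N)
    (X : Matrix ι ι F) (hX : ∀ y x, X y x ≠ 0 → A y x)
    (hc : ∀ y x, h x - h y = d - N → ¬ SlicePos row col y x →
      (shiftMatrix row col F * X) y x = (X * shiftMatrix row col F) y x) :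
    ∀ y x, h x - h y = d → X y x = 0 := by
  -- Commutation off the slice moves an entry one step left in both indices. Here the column of `y`
  -- reaches `0` first, where the entry of `J * X` is zero.
  have hlt : ∀ k, ∀ y x, col y = k → col y < col x → h x - h y = d → X y x = 0 := by
    intro k
    induction k with
    | zero =>
      intro y x hy hyx hd
      obtain ⟨x', hx'⟩ := hf.pred x (by omega)
      have h1 := hc y x' (by rw [hN x' x hx'] at hd; omega) fun h' => h'.1 ⟨x, hx'⟩
      rw [hf.mul_shiftMatrix_apply X hx',
        IsFilling.shiftMatrix_mul_apply_eq_zero X (fun y' h' => by have := h'.2; omega)] at h1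
      exact h1.symm
    | succ k ih =>
      intro y x hy hyx hd
      obtain ⟨x', hx'⟩ := hf.pred x (by omega)
      obtain ⟨y', hy'⟩ := hf.pred y (by omega)
      have h1 := hc y x' (by rw [hN x' x hx'] at hd; omega) fun h' => h'.1 ⟨x, hx'⟩
      rw [hf.mul_shiftMatrix_apply X hx', hf.shiftMatrix_mul_apply X hy'] at h1
      rw [← h1]
      have h2 := hx'.2
      have h3 := hy'.2
      refine ih y' x' (by omega) (by omega) ?_
      rw [hN x' x hx', hN y' y hy'] at hd
      omega
  -- Here entries move one step right instead. A nonzero entry forces `y` to have a right neighbour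
  -- `z`, and `(z, x)` is off the slice because `z` lies to the right of `x`. The process stops when
  -- the row of `x` ends.
  have hge : ∀ k, ∀ y x, Finset.univ.sup col = col x + k → col x ≤ col y → h x - h y = d →
      X y x = 0 := by
    intro k
    induction k with
    | zero =>
      intro y x hk hxy hd
      by_contra hne
      obtain ⟨z, hz⟩ := hA.exists_next y x (hX y x hne) hxy
      have h1 : col z ≤ Finset.univ.sup col := Finset.le_sup (Finset.mem_univ z)
      have h2 := hz.2
      omega
    | succ k ih =>
      intro y x hk hxy hd
      by_contra hne
      obtain ⟨z, hz⟩ := hA.exists_next y x (hX y x hne) hxy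
      have hz2 := hz.2
      have h1 := hc z x (by rw [hN y z hz]; omega) fun h' => by have := h'.2; omega
      rw [hf.shiftMatrix_mul_apply X hz] at h1
      apply hne
      rw [h1]
      by_cases hx : ∃ x', Next row col x x'
      · obtain ⟨x', hx'⟩ := hx
        rw [hf.mul_shiftMatrix_apply X hx']
        have h3 := hx'.2
        refine ih z x' (by omega) (by omega) ?_
        rw [hN x x' hx', hN y z hz]
        omega
      · exact IsFilling.mul_shiftMatrix_apply_eq_zero X (fun x' h' => hx ⟨x', h'⟩) z
  intro y x hd
  rcases lt_or_ge (col y) (col x) with h1 | h1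
  · exact hlt _ y x rfl h1 hd
  · have h2 : col x ≤ Finset.univ.sup col := Finset.le_sup (Finset.mem_univ x)
    exact hge (Finset.univ.sup col - col x) y x (by omega) h1 hd

-- The slice therefore lies in the coset `J + A^⊥`.
omit hf [Fintype ι] in
lemma not_of_slicePos {y x : ι} (h : SlicePos row col y x) : ¬ A x y :=
  fun h' => h.1 (hA.exists_next x y h' h.2)

/-- Distinct elements of the slice are not conjugate under unipotent elements supported on `A`, and
their stabilizers are trivial. -/
lemma eq_zero_of_intertwining (X Z Z' : Matrix ι ι F) (hX : ∀ y x, X y x ≠ 0 → A y x)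
    (hZ : ∀ y x, Z y x ≠ 0 → SlicePos row col y x)
    (hZ' : ∀ y x, Z' y x ≠ 0 → SlicePos row col y x)
    (he : X * shiftMatrix row col F + Z + X * Z = shiftMatrix row col F * X + Z' + Z' * X) :
    X = 0 := by
  obtain ⟨h, N, hN, hpos, hneg⟩ := hA.grading
  -- Induction on the degree `h x - h y`, which is positive on `A`. Entries of `Z` and `Z'` shift
  -- degrees by more than `-N`, so at each stage the quadratic terms involve only entries of `X`
  -- already known to vanish, leaving the linear commutator equation.
  have hdeg : ∀ d : ℕ, ∀ y x, h x - h y ≤ d → X y x = 0 := by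
    intro d
    induction d with
    | zero =>
      intro y x hd
      by_contra hne
      have := hpos y x (hX y x hne)
      omega
    | succ d ih =>
      intro y x hd
      rcases lt_or_ge (h x - h y) ((d + 1 : ℕ) : ℤ) with h1 | h1
      · exact ih y x (by push_cast at h1; omega)
      refine hA.eq_zero_of_commutator hf h N _ hN X hX ?_ y x (le_antisymm hd h1)
      intro y x hyx hS
      have hz : Z y x = 0 := by
        by_contra hne
        exact hS (hZ y x hne)
      have hz' : Z' y x = 0 := by
        by_contra hne
        exact hS (hZ' y x hne)
      have h2 : (X * Z) y x = 0 := by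
        rw [Matrix.mul_apply]
        refine Finset.sum_eq_zero fun k _ => ?_
        by_contra hne
        have h3 := hneg x k (hA.not_of_slicePos (hZ k x (right_ne_zero_of_mul hne)))
        refine left_ne_zero_of_mul hne (ih y k ?_)
        push_cast at hyx
        omega
      have h3 : (Z' * X) y x = 0 := by
        rw [Matrix.mul_apply]
        refine Finset.sum_eq_zero fun k _ => ?_
        by_contra hne
        have h3 := hneg k y (hA.not_of_slicePos (hZ' y k (left_ne_zero_of_mul hne)))
        refine right_ne_zero_of_mul hne (ih k x ?_)
        push_cast at hyx
        omega
      have h4 := congrFun (congrFun he y) x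
      simp only [Matrix.add_apply] at h4
      rw [hz, hz', h2, h3, add_zero, add_zero, add_zero, add_zero] at h4
      exact h4.symm
  ext y x
  exact hdeg (h x - h y).toNat y x (Int.self_le_toNat _)

omit hf in
lemma mul_perp {X Z : Matrix ι ι F} (hX : ∀ y x, X y x ≠ 0 → A y x)
    (hZ : ∀ y x, Z y x ≠ 0 → ¬ A x y) (y x : ι) (h : (X * Z) y x ≠ 0) : ¬ A x y := by
  intro hxy
  rw [Matrix.mul_apply] at h
  obtain ⟨k, -, hk⟩ := Finset.exists_ne_zero_of_sum_ne_zero h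
  exact hZ k x (right_ne_zero_of_mul hk)
    (hA.trans _ _ _ hxy (hX y k (left_ne_zero_of_mul hk)))

omit hf in
lemma perp_mul {X Z : Matrix ι ι F} (hX : ∀ y x, X y x ≠ 0 → A y x)
    (hZ : ∀ y x, Z y x ≠ 0 → ¬ A x y) (y x : ι) (h : (Z * X) y x ≠ 0) : ¬ A x y := by
  intro hxy
  rw [Matrix.mul_apply] at h
  obtain ⟨k, -, hk⟩ := Finset.exists_ne_zero_of_sum_ne_zero h
  exact hZ y k (left_ne_zero_of_mul hk)
    (hA.trans _ _ _ (hX k x (right_ne_zero_of_mul hk)) hxy)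

omit hf in
lemma mul_shiftMatrix_perp {X : Matrix ι ι F} (hX : ∀ y x, X y x ≠ 0 → A y x) (y x : ι)
    (h : (X * shiftMatrix row col F) y x ≠ 0) : ¬ A x y := by
  intro hxy
  rw [Matrix.mul_apply] at h
  obtain ⟨k, -, hk⟩ := Finset.exists_ne_zero_of_sum_ne_zero h
  have h1 : Next row col x k := by
    by_contra h'
    exact right_ne_zero_of_mul hk (if_neg h')
  exact hA.not_next x y k h1 hxy (hX y k (left_ne_zero_of_mul hk))

omit hf in
lemma shiftMatrix_mul_perp {X : Matrix ι ι F} (hX : ∀ y x, X y x ≠ 0 → A y x) (y x : ι)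
    (h : (shiftMatrix row col F * X) y x ≠ 0) : ¬ A x y := by
  intro hxy
  rw [Matrix.mul_apply] at h
  obtain ⟨k, -, hk⟩ := Finset.exists_ne_zero_of_sum_ne_zero h
  have h1 : Next row col k y := by
    by_contra h'
    exact left_ne_zero_of_mul hk (if_neg h')
  exact hA.not_next k x y h1 (hX k x (right_ne_zero_of_mul hk)) hxy

omit hf in
/-- The coset `J + A^⊥` is stable under conjugation. -/
lemma conj_perp [DecidableEq ι] {u W v : Matrix ι ι F}
    (hu : ∀ y x, (u - 1) y x ≠ 0 → A y x) (hv : ∀ y x, (v - 1) y x ≠ 0 → A y x)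
    (hW : ∀ y x, (W - shiftMatrix row col F) y x ≠ 0 → ¬ A x y) (y x : ι)
    (h : (u * W * v - shiftMatrix row col F) y x ≠ 0) : ¬ A x y := by
  set J := shiftMatrix row col F with hJ
  have hadd : ∀ M M' M'' : Matrix ι ι F, (∀ y x, M y x ≠ 0 → ¬ A x y) →
      (∀ y x, M' y x ≠ 0 → ¬ A x y) → (∀ y x, M'' y x ≠ 0 → ¬ A x y) →
      ∀ y x, (M + M' + M'') y x ≠ 0 → ¬ A x y := by
    intro M M' M'' h1 h2 h3 y x hne hxy
    apply hne
    rw [Matrix.add_apply, Matrix.add_apply, not_not.1 (mt (h1 y x) (not_not.2 hxy)),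
      not_not.1 (mt (h2 y x) (not_not.2 hxy)), not_not.1 (mt (h3 y x) (not_not.2 hxy))]
    simp
  have h1 : ∀ y x, (u * W - J) y x ≠ 0 → ¬ A x y := by
    have : u * W - J = (u - 1) * J + (u - 1) * (W - J) + (W - J) := by noncomm_ring
    rw [this]
    exact hadd _ _ _ (hA.mul_shiftMatrix_perp hu) (hA.mul_perp hu hW) hW
  have h2 : ∀ y x, (u * W * v - J) y x ≠ 0 → ¬ A x y := by
    have : u * W * v - J = J * (v - 1) + (u * W - J) * (v - 1) + (u * W - J) := by noncomm_ring
    rw [this]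
    exact hadd _ _ _ (hA.shiftMatrix_mul_perp hv) (hA.perp_mul hv h1) h1
  exact h2 y x h

end IsPolarization

variable (row col) in
/-- The slice: shift matrix plus arbitrary entries in the positions `SlicePos`. -/
def Slice (F : Type*) [Field F] : Type _ :=
  {W : Matrix ι ι F // ∀ y x, (W - shiftMatrix row col F) y x ≠ 0 → SlicePos row col y x}

variable (row col) in
/-- The coset `J + A^⊥`. -/
def PerpCoset (A : ι → ι → Prop) (F : Type*) [Field F] : Type _ :=
  {W : Matrix ι ι F // ∀ y x, (W - shiftMatrix row col F) y x ≠ 0 → ¬ A x y}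

instance {F : Type*} [Field F] [Finite F] [Finite ι] : Finite (Slice row col F) :=
  inferInstanceAs (Finite {_W : Matrix ι ι F // _})

instance {F : Type*} [Field F] [Finite F] [Finite ι] (A : ι → ι → Prop) :
    Finite (PerpCoset row col A F) :=
  inferInstanceAs (Finite {_W : Matrix ι ι F // _})

/-- A coset of a space of matrices given by their support. -/
def supportedCosetEquiv {F : Type*} [Field F] (J : Matrix ι ι F) (P : ι → ι → Prop) :
    {W : Matrix ι ι F // ∀ y x, (W - J) y x ≠ 0 → P y x} ≃
      {Z : Matrix ι ι F // ∀ y x, Z y x ≠ 0 → P y x} where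
  toFun W := ⟨W.1 - J, W.2⟩
  invFun Z := ⟨J + Z.1, by simpa only [add_sub_cancel_left] using Z.2⟩
  left_inv W := Subtype.ext (add_sub_cancel _ _)
  right_inv Z := Subtype.ext (add_sub_cancel_left _ _)

lemma card_slice {F : Type*} [Field F] [Finite F] [Finite ι] : Nat.card (Slice row col F) =
    Nat.card F ^ Nat.card {p : ι × ι // SlicePos row col p.1 p.2} := by
  rw [← card_supportedMatrix (SlicePos row col)]
  exact Nat.card_congr (supportedCosetEquiv _ _)

lemma card_perpCoset {F : Type*} [Field F] [Finite F] [Finite ι] (A : ι → ι → Prop) :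
    Nat.card (PerpCoset row col A F) =
      Nat.card F ^ (Nat.card ι ^ 2 - Nat.card {p : ι × ι // A p.1 p.2}) := by
  classical
  have := Fintype.ofFinite ι
  have h1 : Nat.card {p : ι × ι // ¬ A p.2 p.1} =
      Nat.card ι ^ 2 - Nat.card {p : ι × ι // A p.1 p.2} := by
    have e : {p : ι × ι // ¬ A p.2 p.1} ≃ {p : ι × ι // ¬ A p.1 p.2} :=
      (Equiv.prodComm ι ι).subtypeEquiv fun _ => Iff.rfl
    rw [Nat.card_congr e]
    simp only [Nat.card_eq_fintype_card]
    rw [Fintype.card_subtype_compl, Fintype.card_prod, sq]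
  rw [← h1, ← card_supportedMatrix (fun y x => ¬ A x y)]
  exact Nat.card_congr (supportedCosetEquiv _ _)

variable {A : ι → ι → Prop} {F : Type*} [Field F] [Fintype ι] [DecidableEq ι]

/-- The action of unipotent elements on the slice. -/
def sliceAction (hA : IsPolarization row col A) (H : Subgroup (GL ι F))
    (hH : ∀ g, g ∈ H ↔ ∀ i j, (g.1 - 1) i j ≠ 0 → A i j) (p : H × Slice row col F) :
    PerpCoset row col A F :=
  ⟨p.1.1.1 * p.2.1 * (p.1.1⁻¹).1, hA.conj_perp ((hH _).1 p.1.2) ((hH _).1 (H.inv_mem p.1.2))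
    fun y x h => hA.not_of_slicePos (p.2.2 y x h)⟩

/-- If two pairs have the same image, the quotient of their group elements intertwines two points of
the slice, hence is `1`. Surjectivity follows by counting: the `card` condition says exactly that
both sides have the same size. -/
lemma sliceAction_bijective [Finite F] (hf : IsFilling row col) (hA : IsPolarization row col A)
    (H : Subgroup (GL ι F)) (hH : ∀ g, g ∈ H ↔ ∀ i j, (g.1 - 1) i j ≠ 0 → A i j)
    (hcard : Nat.card H = Nat.card F ^ Nat.card {p : ι × ι // A p.1 p.2}) :
    Function.Bijective (sliceAction hA H hH) := by
  rw [Nat.bijective_iff_injective_and_card]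
  constructor
  · rintro ⟨u, s⟩ ⟨v, s'⟩ h
    have h1 : u.1.1 * s.1 * (u.1⁻¹).1 = v.1.1 * s'.1 * (v.1⁻¹).1 := congrArg Subtype.val h
    have h2 : (v⁻¹ * u).1.1 * s.1 = s'.1 * (v⁻¹ * u).1.1 := by
      have h3 : (v.1⁻¹).1 * (u.1.1 * s.1 * (u.1⁻¹).1) * u.1.1 =
          (v.1⁻¹).1 * (v.1.1 * s'.1 * (v.1⁻¹).1) * u.1.1 := by rw [h1]
      have h4 : (u.1⁻¹).1 * u.1.1 = 1 := by rw [← Units.val_mul]; simp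
      have h5 : (v.1⁻¹).1 * v.1.1 = 1 := by rw [← Units.val_mul]; simp
      have h6 : (v⁻¹ * u).1.1 = (v.1⁻¹).1 * u.1.1 := rfl
      rw [h6]
      calc (v.1⁻¹).1 * u.1.1 * s.1
          = (v.1⁻¹).1 * (u.1.1 * s.1 * (u.1⁻¹).1) * u.1.1 := by
            simp only [mul_assoc, h4, mul_one]
        _ = _ := h3
        _ = ((v.1⁻¹).1 * v.1.1) * s'.1 * ((v.1⁻¹).1 * u.1.1) := by simp only [mul_assoc]
        _ = _ := by rw [h5, one_mul]
    have h3 : (v⁻¹ * u).1.1 - 1 = 0 := by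
      refine hA.eq_zero_of_intertwining hf _ (s.1 - shiftMatrix row col F)
        (s'.1 - shiftMatrix row col F) ((hH _).1 (v⁻¹ * u).2) s.2 s'.2 ?_
      have : ∀ w a b J : Matrix ι ι F, w * a = b * w →
          (w - 1) * J + (a - J) + (w - 1) * (a - J) = J * (w - 1) + (b - J) + (b - J) * (w - 1) := by
        intro w a b J hw
        have h7 : (w - 1) * J + (a - J) + (w - 1) * (a - J) = w * a - J := by noncomm_ring
        have h8 : J * (w - 1) + (b - J) + (b - J) * (w - 1) = b * w - J := by noncomm_ring
        rw [h7, h8, hw]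
      exact this _ _ _ _ h2
    have h4 : v⁻¹ * u = 1 := Subtype.ext (Units.ext (sub_eq_zero.1 h3))
    have h5 : u = v := (inv_mul_eq_one.1 h4).symm
    rw [h4] at h2
    refine Prod.ext h5 (Subtype.ext ?_)
    simpa using h2
  · rw [Nat.card_prod, hcard, card_slice, card_perpCoset, ← pow_add, ← hA.card]
    congr 1
    omega

variable [Fintype F]

/-- Orthogonality of the characters of the space of matrices. -/
lemma sum_perpCoset [Fintype (PerpCoset row col A F)] (ϑ : AddChar F ℂ) (hϑ : ϑ ≠ 1)
    (M : Matrix ι ι F) [Decidable (∀ i j, M i j ≠ 0 → A i j)] :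
    ∑ W : PerpCoset row col A F, ϑ (W.1 * M).trace =
      if ∀ i j, M i j ≠ 0 → A i j then
        (Nat.card (PerpCoset row col A F) : ℂ) * ϑ (shiftMatrix row col F * M).trace else 0 := by
  classical
  split_ifs with hM
  · have h1 : ∀ W : PerpCoset row col A F,
        ϑ (W.1 * M).trace = ϑ (shiftMatrix row col F * M).trace := by
      intro W
      have h2 : W.1 * M = shiftMatrix row col F * M + (W.1 - shiftMatrix row col F) * M := by
        noncomm_ring
      rw [h2, Matrix.trace_add]
      have h3 : ((W.1 - shiftMatrix row col F) * M).trace = 0 := by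
        rw [Matrix.trace]
        refine Finset.sum_eq_zero fun y _ => ?_
        rw [Matrix.diag_apply, Matrix.mul_apply]
        refine Finset.sum_eq_zero fun x _ => ?_
        by_contra hne
        exact W.2 y x (left_ne_zero_of_mul hne) (hM x y (right_ne_zero_of_mul hne))
      rw [h3, add_zero]
    rw [Finset.sum_congr rfl fun W _ => h1 W, Finset.sum_const, Finset.card_univ, nsmul_eq_mul,
      Nat.card_eq_fintype_card]
  · push Not at hM
    obtain ⟨x, y, hne, hxy⟩ := hM
    let S : Set (Matrix ι ι F) := {W | ∀ y x, (W - shiftMatrix row col F) y x ≠ 0 → ¬ A x y}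
    have hS : ∀ t W, W ∈ S → Matrix.single y x t + W ∈ S := by
      intro t W hW a b hab hba
      apply hab
      rw [Matrix.sub_apply, Matrix.add_apply, Matrix.single_apply_of_ne, zero_add,
        ← Matrix.sub_apply]
      · by_contra h'
        exact hW a b h' hba
      · rintro ⟨rfl, rfl⟩
        exact hxy hba
    -- A nonzero entry of `M` at `(x, y)` outside `A` pairs with the free entry `(y, x)` of the
    -- coset; translating that entry gives a nontrivial character sum.
    have h1 : ∑ W : Matrix ι ι F, (if W ∈ S then ϑ (W * M).trace else 0) = 0 := by
      refine sum_eq_zero_of_permute ϑ hϑ _ (fun t => Equiv.addLeft (Matrix.single y x (-t)))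
        (fun _ => M x y) (fun _ _ => hne) ?_ ?_
      · intro t W hW
        have hWS : W ∈ S := by
          by_contra h'
          exact hW (if_neg h')
        rw [Equiv.coe_addLeft, if_pos hWS, if_pos (hS (-t) _ hWS), add_mul, add_comm,
          Matrix.trace_add, Matrix.trace_single_mul, smul_eq_mul, neg_mul,
          AddChar.map_add_eq_mul]
      · intro t W hW
        rw [Equiv.coe_addLeft]
        by_contra h'
        have hWS : Matrix.single y x (-t) + W ∈ S := by
          by_contra h''
          exact h' (if_neg h'')
        have h2 := hS t _ hWS
        rw [← add_assoc, ← Matrix.single_add, add_neg_cancel, Matrix.single_zero, zero_add] at h2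
        rw [if_pos h2] at hW
        exact absurd hW (ϑ.val_isUnit _).ne_zero
    rw [← Finset.sum_filter] at h1
    rw [← h1]
    refine (Finset.sum_subtype (p := fun W => W ∈ S) _ (fun W => ?_)
      (fun W => ϑ (W * M).trace)).symm
    simp only [Finset.mem_filter, Finset.mem_univ, true_and]

/-- The induced character in terms of the slice only. -/
theorem sum_conj_eq_sum_slice [Fintype (Slice row col F)] [Fintype (GL ι F)]
    (hf : IsFilling row col) (hA : IsPolarization row col A)
    (ϑ : AddChar F ℂ) (hϑ : ϑ ≠ 1) (H : Subgroup (GL ι F))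
    (hH : ∀ g, g ∈ H ↔ ∀ i j, (g.1 - 1) i j ≠ 0 → A i j)
    (hcard : Nat.card H = Nat.card F ^ Nat.card {p : ι × ι // A p.1 p.2}) (g : GL ι F) :
    ind H (fun u => ϑ (shiftMatrix row col F * (u.1.1 - 1)).trace) g =
      ((Nat.card H : ℂ) * (Nat.card (Slice row col F) : ℂ))⁻¹ *
        ∑ s : Slice row col F, ∑ x : GL ι F, ϑ (s.1 * (x.1 * (g.1 - 1) * (x⁻¹).1)).trace := by
  classical
  have := Fintype.ofFinite (PerpCoset row col A F)
  have hbij := sliceAction_bijective hf hA H hH hcard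
  have hP : (Nat.card (PerpCoset row col A F) : ℂ) = Nat.card H * Nat.card (Slice row col F) := by
    rw [← Nat.card_congr (Equiv.ofBijective _ hbij), Nat.card_prod, Nat.cast_mul]
  have hH0 : (Nat.card H : ℂ) ≠ 0 := by exact_mod_cast Nat.card_pos.ne'
  have hP0 : (Nat.card (PerpCoset row col A F) : ℂ) ≠ 0 := by
    have : Nonempty (PerpCoset row col A F) :=
      ⟨⟨shiftMatrix row col F, fun y x h => by simp at h⟩⟩
    exact_mod_cast Nat.card_pos.ne'
  have h1 : ∀ x : GL ι F,
      extendZero H (fun u => ϑ (shiftMatrix row col F * (u.1.1 - 1)).trace) (x * g * x⁻¹) =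
        (Nat.card (PerpCoset row col A F) : ℂ)⁻¹ *
          ∑ W : PerpCoset row col A F, ϑ (W.1 * (x.1 * (g.1 - 1) * (x⁻¹).1)).trace := by
    intro x
    have hx : (x * g * x⁻¹).1 - 1 = x.1 * (g.1 - 1) * (x⁻¹).1 := by
      have : x.1 * (x⁻¹).1 = 1 := by rw [← Units.val_mul]; simp
      rw [mul_sub, sub_mul, mul_one, this, Units.val_mul, Units.val_mul]
    rw [sum_perpCoset ϑ hϑ, ← hx]
    by_cases hm : x * g * x⁻¹ ∈ H
    · rw [extendZero_of_mem hm, if_pos ((hH _).1 hm), inv_mul_cancel_left₀ hP0]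
    · rw [extendZero_of_notMem hm, if_neg (mt (hH _).2 hm), mul_zero]
  have h2 : ∑ x : GL ι F, ∑ W : PerpCoset row col A F,
      ϑ (W.1 * (x.1 * (g.1 - 1) * (x⁻¹).1)).trace = (Nat.card H : ℂ) *
        ∑ s : Slice row col F, ∑ x : GL ι F, ϑ (s.1 * (x.1 * (g.1 - 1) * (x⁻¹).1)).trace := by
    rw [Finset.sum_comm, ← (Equiv.ofBijective _ hbij).sum_comp, Fintype.sum_prod_type]
    -- By invariance of the trace, conjugating `s` by `u` amounts to replacing `x` by `u⁻¹ * x`.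
    have h3 : ∀ u : H, ∑ s : Slice row col F, ∑ x : GL ι F,
        ϑ (((Equiv.ofBijective _ hbij) (u, s)).1 * (x.1 * (g.1 - 1) * (x⁻¹).1)).trace =
        ∑ s : Slice row col F, ∑ x : GL ι F, ϑ (s.1 * (x.1 * (g.1 - 1) * (x⁻¹).1)).trace := by
      intro u
      refine Finset.sum_congr rfl fun s _ => ?_
      refine Fintype.sum_equiv (Equiv.mulLeft u.1⁻¹) _ _ fun x => ?_
      congr 1
      change (u.1.1 * s.1 * (u.1⁻¹).1 * (x.1 * (g.1 - 1) * (x⁻¹).1)).trace = _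
      have h4 : (Equiv.mulLeft u.1⁻¹ x) = u.1⁻¹ * x := rfl
      rw [h4, mul_inv_rev, inv_inv, Units.val_mul, Units.val_mul]
      simp only [mul_assoc]
      rw [Matrix.trace_mul_comm]
      simp only [mul_assoc]
    rw [Finset.sum_congr rfl fun u _ => h3 u, Finset.sum_const, Finset.card_univ, nsmul_eq_mul,
      Nat.card_eq_fintype_card]
  rw [ind_apply, Finset.sum_congr rfl fun x _ => h1 x, ← Finset.mul_sum, h2, hP]
  field_simp

end Slices

/-! ### Independence of the labelling. -/

section Relabel

variable {ι : Type*} [Fintype ι] [DecidableEq ι] {F : Type*} [Field F]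

/-- The permutation matrix of `σ` in `GL`. -/
def permGL (F : Type*) [Field F] (σ : Equiv.Perm ι) : GL ι F where
  val := (1 : Matrix ι ι F).submatrix σ.symm id
  inv := (1 : Matrix ι ι F).submatrix id σ.symm
  val_inv := by
    rw [← Matrix.submatrix_mul _ _ _ _ _ Function.bijective_id, one_mul]
    exact Matrix.submatrix_one_equiv σ.symm
  inv_val := by
    rw [← Matrix.submatrix_mul _ _ _ _ _ σ.symm.bijective, one_mul, Matrix.submatrix_id_id]

lemma permGL_conj (σ : Equiv.Perm ι) (W : Matrix ι ι F) :
    (permGL F σ).1 * W * ((permGL F σ)⁻¹).1 = W.submatrix σ.symm σ.symm := by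
  have h1 : (permGL F σ).1 * W = W.submatrix σ.symm id := by
    have := Matrix.submatrix_mul (1 : Matrix ι ι F) W σ.symm id id Function.bijective_id
    rw [one_mul, Matrix.submatrix_id_id] at this
    exact this.symm
  have h2 := Matrix.submatrix_mul W (1 : Matrix ι ι F) σ.symm id σ.symm Function.bijective_id
  rw [mul_one] at h2
  rw [h1, h2]
  rfl

variable {row col row' col' : ι → ℕ} (σ : Equiv.Perm ι) (hrow : ∀ i, row' (σ i) = row i)
  (hcol : ∀ i, col' (σ i) = col i)

include hrow hcol

omit [Fintype ι] [DecidableEq ι] in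
lemma next_relabel (i j : ι) : Next row' col' (σ i) (σ j) ↔ Next row col i j := by
  simp only [Next, hrow, hcol]

omit [Fintype ι] [DecidableEq ι] in
lemma slicePos_relabel (i j : ι) : SlicePos row' col' (σ i) (σ j) ↔ SlicePos row col i j := by
  simp only [SlicePos, hcol, ← σ.exists_congr_right (q := fun z => Next row' col' (σ j) z),
    next_relabel σ hrow hcol]

omit [Fintype ι] [DecidableEq ι] in
lemma shiftMatrix_relabel :
    shiftMatrix row' col' F = (shiftMatrix row col F).submatrix σ.symm σ.symm := by
  ext i j
  have := next_relabel σ hrow hcol (σ.symm j) (σ.symm i)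
  simp only [Equiv.apply_symm_apply] at this
  simp only [shiftMatrix, Matrix.of_apply, Matrix.submatrix_apply]
  by_cases h : Next row' col' j i
  · rw [if_pos h, if_pos (this.1 h)]
  · rw [if_neg h, if_neg (mt this.2 h)]

/-- The slices of two labellings of the same diagram. -/
def sliceRelabel : Slice row col F ≃ Slice row' col' F where
  toFun W := ⟨W.1.submatrix σ.symm σ.symm, fun y x h => by
    rw [shiftMatrix_relabel σ hrow hcol] at h
    simpa using (slicePos_relabel σ hrow hcol _ _).2 (W.2 (σ.symm y) (σ.symm x) h)⟩
  invFun W := ⟨W.1.submatrix σ σ, fun y x h => by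
    have h1 : shiftMatrix row col F = (shiftMatrix row' col' F).submatrix σ σ := by
      rw [shiftMatrix_relabel σ hrow hcol]
      simp
    rw [h1] at h
    exact (slicePos_relabel σ hrow hcol _ _).1 (W.2 (σ y) (σ x) h)⟩
  left_inv W := Subtype.ext (by simp)
  right_inv W := Subtype.ext (by simp)

/-- Relabelling conjugates the slice by a permutation matrix, which the sum over the general linear
group absorbs. -/
lemma sum_slice_relabel [Fintype F] [Fintype (Slice row col F)] [Fintype (Slice row' col' F)]
    [Fintype (GL ι F)] (ϑ : AddChar F ℂ) (M : Matrix ι ι F) :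
    ∑ s : Slice row col F, ∑ x : GL ι F, ϑ (s.1 * (x.1 * M * (x⁻¹).1)).trace =
      ∑ s : Slice row' col' F, ∑ x : GL ι F, ϑ (s.1 * (x.1 * M * (x⁻¹).1)).trace := by
  refine Fintype.sum_equiv (sliceRelabel σ hrow hcol) _ _ fun s => ?_
  refine Fintype.sum_equiv (Equiv.mulLeft (permGL F σ)) _ _ fun x => ?_
  congr 1
  change _ = (s.1.submatrix σ.symm σ.symm *
    ((permGL F σ * x).1 * M * ((permGL F σ * x)⁻¹).1)).trace
  have hinv : ((permGL F σ)⁻¹).1 * (permGL F σ).1 = 1 := by rw [← Units.val_mul]; simp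
  rw [← permGL_conj, mul_inv_rev, Units.val_mul, Units.val_mul]
  have h1 : (permGL F σ).1 * s.1 * ((permGL F σ)⁻¹).1 *
      ((permGL F σ).1 * x.1 * M * ((x⁻¹).1 * ((permGL F σ)⁻¹).1)) =
      (permGL F σ).1 * (s.1 * (((permGL F σ)⁻¹).1 * (permGL F σ).1) * x.1 * M * (x⁻¹).1 *
        ((permGL F σ)⁻¹).1) := by
    simp only [mul_assoc]
  rw [h1, Matrix.trace_mul_comm (permGL F σ).1, hinv, mul_assoc _ _ (permGL F σ).1, hinv]
  simp only [mul_assoc, mul_one]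

end Relabel

/-! ### Counting pairs of cells. -/

section Counting

/-- Pairs ordered by an asymmetric relation, and pairs that are not. -/
lemma two_mul_card_add_card {α : Type*} (s : Finset α) (B : α → α → Prop) [DecidableRel B]
    (hB : ∀ x y, B x y → ¬ B y x) :
    2 * ((s ×ˢ s).filter fun p => B p.1 p.2).card +
      ((s ×ˢ s).filter fun p => ¬ B p.1 p.2 ∧ ¬ B p.2 p.1).card = s.card ^ 2 := by
  have h1 : ((s ×ˢ s).filter fun p => B p.2 p.1).card =
      ((s ×ˢ s).filter fun p => B p.1 p.2).card := by
    refine Finset.card_nbij' Prod.swap Prod.swap ?_ ?_ ?_ ?_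
    · rintro ⟨x, y⟩ h
      simp only [Finset.coe_filter, Finset.mem_product, Set.mem_ofPred_eq, Prod.fst_swap,
        Prod.snd_swap] at h ⊢
      tauto
    · rintro ⟨x, y⟩ h
      simp only [Finset.coe_filter, Finset.mem_product, Set.mem_ofPred_eq, Prod.fst_swap,
        Prod.snd_swap] at h ⊢
      tauto
    · exact fun _ _ => rfl
    · exact fun _ _ => rfl
  have h2 := Finset.card_filter_add_card_filter_not (s := s ×ˢ s) (fun p => B p.1 p.2)
  have h3 := Finset.card_filter_add_card_filter_not
    (s := (s ×ˢ s).filter fun p => ¬ B p.1 p.2) (fun p => B p.2 p.1)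
  rw [Finset.filter_filter, Finset.filter_filter] at h3
  have h4 : ((s ×ˢ s).filter fun p => ¬ B p.1 p.2 ∧ B p.2 p.1) =
      (s ×ˢ s).filter fun p => B p.2 p.1 :=
    Finset.filter_congr fun p _ => ⟨fun h => h.2, fun h => ⟨hB _ _ h, h⟩⟩
  rw [h4] at h3
  rw [Finset.card_product] at h2
  rw [sq]
  omega

variable (μ : YoungDiagram)

/-- The number of pairs of cells in the same column. -/
def sameColumn : Finset ((ℕ × ℕ) × (ℕ × ℕ)) :=
  (μ.cells ×ˢ μ.cells).filter fun p => p.1.2 = p.2.2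

/-- The second cell ends its row; sliding it left into the column of the first loses no information,
since the row determines its end. -/
lemma card_slicePos : ((μ.cells ×ˢ μ.cells).filter fun p =>
    p.2.2 + 1 = μ.rowLen p.2.1 ∧ p.1.2 ≤ p.2.2).card = (sameColumn μ).card := by
  refine Finset.card_nbij' (fun p => (p.1, (p.2.1, p.1.2)))
    (fun p => (p.1, (p.2.1, μ.rowLen p.2.1 - 1))) ?_ ?_ ?_ ?_
  all_goals
    rintro ⟨⟨a, b⟩, c, d⟩ h
    simp only [sameColumn, Finset.coe_filter, Finset.mem_product, YoungDiagram.mem_cells,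
      YoungDiagram.mem_iff_lt_rowLen, Set.mem_ofPred_eq, Prod.mk.injEq, true_and, and_true] at h ⊢
    omega

/-- The pattern of `U_T` in terms of cells. -/
def TabPattern (x y : ℕ × ℕ) : Prop :=
  x.2 + 2 ≤ y.2 ∨ (y.2 = x.2 + 1 ∧ x.1 ≤ y.1) ∨
    (y.2 = x.2 ∧ x.1 < y.1 ∧ x.2 + 1 < μ.rowLen x.1)

/-- The blocks of `U_{ctr(μ')}` in terms of cells. -/
def ctrBlock (x : ℕ × ℕ) : ℤ := (x.2 : ℤ) - ((μ.rowLen x.1 / 2 : ℕ) : ℤ)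

/-- The pattern of `U_{ctr(μ')}` in terms of cells. -/
def CtrPattern (x y : ℕ × ℕ) : Prop := ctrBlock μ x < ctrBlock μ y

instance : DecidableRel (TabPattern μ) := fun x y => by unfold TabPattern; infer_instance

instance : DecidableRel (CtrPattern μ) := fun x y => by unfold CtrPattern; infer_instance

/-- Incomparable pairs in adjacent columns have the right cell strictly higher; sliding it left
gives the pairs in one column whose higher cell has a right neighbour. The remaining pairs in one
column are already incomparable. -/
lemma card_tabPattern : ((μ.cells ×ˢ μ.cells).filter fun p =>
    ¬ TabPattern μ p.1 p.2 ∧ ¬ TabPattern μ p.2 p.1).card = (sameColumn μ).card := by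
  refine Finset.card_nbij'
    (fun p => if p.2.2 = p.1.2 + 1 then (p.1, (p.2.1, p.1.2)) else
      if p.1.2 = p.2.2 + 1 then ((p.1.1, p.2.2), p.2) else p)
    (fun p => if p.2.1 < p.1.1 ∧ p.2.2 + 1 < μ.rowLen p.2.1 then (p.1, (p.2.1, p.2.2 + 1)) else
      if p.1.1 < p.2.1 ∧ p.1.2 + 1 < μ.rowLen p.1.1 then ((p.1.1, p.1.2 + 1), p.2) else p)
    ?_ ?_ ?_ ?_
  all_goals
    rintro ⟨⟨a, b⟩, c, d⟩ h
    simp only [sameColumn, Finset.coe_filter, Finset.mem_product,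
      YoungDiagram.mem_cells, YoungDiagram.mem_iff_lt_rowLen, Set.mem_ofPred_eq] at h ⊢
    try simp only [TabPattern] at h ⊢
    split_ifs <;> simp only [Prod.mk.injEq, YoungDiagram.mem_iff_lt_rowLen, true_and,
      and_true] at * <;> omega

/-- The map `φ` permutes each row, folding block `b ≥ 0` onto column `2b` and block `-b < 0` onto
column `2b - 1`. So cells of one block correspond to cells of one column. -/
lemma card_ctrPattern : ((μ.cells ×ˢ μ.cells).filter fun p =>
    ¬ CtrPattern μ p.1 p.2 ∧ ¬ CtrPattern μ p.2 p.1).card = (sameColumn μ).card := by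
  let φ : ℕ × ℕ → ℕ × ℕ := fun x => (x.1, if μ.rowLen x.1 / 2 ≤ x.2
    then 2 * (x.2 - μ.rowLen x.1 / 2) else 2 * (μ.rowLen x.1 / 2 - x.2) - 1)
  let ψ : ℕ × ℕ → ℕ × ℕ := fun x => (x.1, if x.2 % 2 = 0
    then x.2 / 2 + μ.rowLen x.1 / 2 else μ.rowLen x.1 / 2 - (x.2 + 1) / 2)
  refine Finset.card_nbij' (fun p => (φ p.1, φ p.2)) (fun p => (ψ p.1, ψ p.2)) ?_ ?_ ?_ ?_
  all_goals
    rintro ⟨⟨a, b⟩, c, d⟩ h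
    simp only [sameColumn, Finset.coe_filter, Finset.mem_product,
      YoungDiagram.mem_cells, YoungDiagram.mem_iff_lt_rowLen, Set.mem_ofPred_eq] at h ⊢
    simp only [φ, ψ, CtrPattern, ctrBlock, Prod.mk.injEq, true_and,
      YoungDiagram.mem_iff_lt_rowLen] at h ⊢
    generalize μ.rowLen a = m at *
    generalize μ.rowLen c = m' at *
    split_ifs <;> omega

end Counting

/-! ### Labelled diagrams and the two polarizations. -/

section Labellings

/-- A bijective filling `T` of `μ` by `0, …, n - 1`, with the cell of each entry. -/
structure Labelling (μ : YoungDiagram) (T : ℕ × ℕ → ℕ) where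
  cell : Fin μ.card → ℕ × ℕ
  mem : ∀ i, cell i ∈ μ
  apply_cell : ∀ i, T (cell i) = i
  surj : ∀ c ∈ μ, ∃ i, cell i = c

variable {μ : YoungDiagram}

lemma reading_lt_card (key : ℕ × ℕ → ℕ ×ₗ ℕ) {c : ℕ × ℕ} (hc : c ∈ μ) :
    reading μ key c < μ.card :=
  Finset.card_lt_card ((Finset.filter_ssubset).2 ⟨c, hc, lt_irrefl _⟩)

/-- The labelling by a reading order with distinct keys. -/
noncomputable def readingLabelling (key : ℕ × ℕ → ℕ ×ₗ ℕ)
    (hkey : ∀ c ∈ μ, ∀ d ∈ μ, key c = key d → c = d) : Labelling μ (reading μ key) :=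
  let f : {c // c ∈ μ.cells} → Fin μ.card := fun c => ⟨reading μ key c.1, reading_lt_card key c.2⟩
  have hf : Function.Bijective f := by
    rw [Fintype.bijective_iff_injective_and_card]
    constructor
    · intro c d h
      have h1 : reading μ key c.1 = reading μ key d.1 := congrArg Fin.val h
      have h2 := mt (reading_lt_iff μ (key := key) (d := d.1) c.2).2 (by omega)
      have h3 := mt (reading_lt_iff μ (key := key) (d := c.1) d.2).2 (by omega)
      exact Subtype.ext (hkey _ c.2 _ d.2 (le_antisymm (not_lt.1 h3) (not_lt.1 h2)))
    · rw [Fintype.card_coe, Fintype.card_fin]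
  { cell := fun i => ((Equiv.ofBijective f hf).symm i).1
    mem := fun i => ((Equiv.ofBijective f hf).symm i).2
    apply_cell := fun i => congrArg Fin.val ((Equiv.ofBijective f hf).apply_symm_apply i)
    surj := fun c hc => ⟨f ⟨c, hc⟩, by
      have : (Equiv.ofBijective f hf).symm (f ⟨c, hc⟩) = ⟨c, hc⟩ :=
        (Equiv.ofBijective f hf).symm_apply_apply _
      rw [this]⟩ }

namespace Labelling

variable {T : ℕ × ℕ → ℕ} (L : Labelling μ T)

/-- The row of an entry. -/
def row (i : Fin μ.card) : ℕ := (L.cell i).1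

/-- The column of an entry. -/
def col (i : Fin μ.card) : ℕ := (L.cell i).2

lemma cell_injective : Function.Injective L.cell := fun i j h =>
  Fin.ext ((L.apply_cell i).symm.trans ((congrArg T h).trans (L.apply_cell j)))

lemma col_lt (i : Fin μ.card) : L.col i < μ.rowLen (L.row i) :=
  YoungDiagram.mem_iff_lt_rowLen.1 (L.mem i)

lemma exists_of_lt {r c : ℕ} (h : c < μ.rowLen r) : ∃ i, L.row i = r ∧ L.col i = c := by
  obtain ⟨i, hi⟩ := L.surj (r, c) (YoungDiagram.mem_iff_lt_rowLen.2 h)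
  exact ⟨i, congrArg Prod.fst hi, congrArg Prod.snd hi⟩

lemma isFilling : IsFilling L.row L.col where
  inj x y h1 h2 := L.cell_injective (Prod.ext h1 h2)
  pred x hx := by
    have := L.col_lt x
    obtain ⟨y, h1, h2⟩ := L.exists_of_lt (r := L.row x) (c := L.col x - 1) (by omega)
    exact ⟨y, h1.symm, by omega⟩

lemma exists_next_iff (i : Fin μ.card) :
    (∃ z, Next L.row L.col i z) ↔ L.col i + 1 < μ.rowLen (L.row i) := by
  constructor
  · rintro ⟨z, h1, h2⟩
    rw [← h1, ← h2]
    exact L.col_lt z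
  · intro h
    obtain ⟨z, h1, h2⟩ := L.exists_of_lt h
    exact ⟨z, h1, h2⟩

lemma mem_rowArcs_iff (a : Fin μ.card × Fin μ.card) :
    a ∈ rowArcs μ T ↔ Next L.row L.col a.1 a.2 := by
  have cell_eq : ∀ (c : ℕ × ℕ), c ∈ μ → ∀ i : Fin μ.card, T c = i → L.cell i = c := by
    intro c hc i h
    obtain ⟨j, rfl⟩ := L.surj c hc
    rw [L.apply_cell] at h
    rw [Fin.ext h]
  constructor
  · intro h
    obtain ⟨r, c, h1, h2, h3, h4⟩ := mem_rowArcs μ h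
    have h5 := cell_eq _ h1 _ h3
    have h6 := cell_eq _ h2 _ h4
    exact ⟨by rw [row, row, h5, h6], by rw [col, col, h5, h6]⟩
  · rintro ⟨h1, h2⟩
    have h5 : L.cell a.2 = (L.row a.1, L.col a.1 + 1) := Prod.ext h1 h2
    simp only [rowArcs, Finset.mem_filter, Finset.mem_univ, true_and]
    refine ⟨L.row a.1, L.col a.1, L.mem a.1, h5 ▸ L.mem a.2,
      L.apply_cell a.1, ?_⟩
    rw [← h5]
    exact L.apply_cell a.2

lemma card_pairs (B : ℕ × ℕ → ℕ × ℕ → Prop) [DecidableRel B] :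
    Nat.card {p : Fin μ.card × Fin μ.card // B (L.cell p.1) (L.cell p.2)} =
      ((μ.cells ×ˢ μ.cells).filter fun p => B p.1 p.2).card := by
  rw [Nat.card_eq_fintype_card, Fintype.card_subtype]
  refine Finset.card_bij (fun p _ => (L.cell p.1, L.cell p.2)) ?_ ?_ ?_
  · intro p hp
    rw [Finset.mem_filter] at hp ⊢
    exact ⟨Finset.mem_product.2 ⟨L.mem _, L.mem _⟩, hp.2⟩
  · intro p _ p' _ h
    exact Prod.ext (L.cell_injective (congrArg Prod.fst h)) (L.cell_injective (congrArg Prod.snd h))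
  · rintro ⟨c, d⟩ h
    rw [Finset.mem_filter, Finset.mem_product] at h
    obtain ⟨i, rfl⟩ := L.surj c h.1.1
    obtain ⟨j, rfl⟩ := L.surj d h.1.2
    exact ⟨(i, j), by rw [Finset.mem_filter]; exact ⟨Finset.mem_univ _, h.2⟩, rfl⟩

lemma card_eq (B : ℕ × ℕ → ℕ × ℕ → Prop) [DecidableRel B] (hB : ∀ x y, B x y → ¬ B y x)
    (hcard : ((μ.cells ×ˢ μ.cells).filter fun p => ¬ B p.1 p.2 ∧ ¬ B p.2 p.1).card =
      (sameColumn μ).card) :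
    2 * Nat.card {p : Fin μ.card × Fin μ.card // B (L.cell p.1) (L.cell p.2)} +
      Nat.card {p : Fin μ.card × Fin μ.card // SlicePos L.row L.col p.1 p.2} =
      Nat.card (Fin μ.card) ^ 2 := by
  have h1 : ∀ p : Fin μ.card × Fin μ.card, SlicePos L.row L.col p.1 p.2 ↔
      (L.cell p.2).2 + 1 = μ.rowLen (L.cell p.2).1 ∧ (L.cell p.1).2 ≤ (L.cell p.2).2 := by
    intro p
    rw [SlicePos, L.exists_next_iff]
    have := L.col_lt p.2
    simp only [row, col] at this ⊢
    omega
  rw [Nat.card_congr (Equiv.subtypeEquivRight h1), L.card_pairs,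
    L.card_pairs (fun x y => y.2 + 1 = μ.rowLen y.1 ∧ x.2 ≤ y.2), card_slicePos, ← hcard,
    two_mul_card_add_card _ _ hB, Nat.card_fin]

lemma isPolarization_tabPattern :
    IsPolarization L.row L.col (fun i j => TabPattern μ (L.cell i) (L.cell j)) where
  trans x y z h1 h2 := by
    simp only [TabPattern] at *
    omega
  not_next x y z h h1 h2 := by
    simp only [TabPattern, Next, row, col] at *
    omega
  exists_next y x h1 h2 := by
    rw [L.exists_next_iff]
    simp only [TabPattern, row, col] at *
    omega
  grading := by
    have hrow : ∀ x, L.row x < μ.colLen 0 := fun x =>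
      YoungDiagram.mem_iff_lt_colLen.1
        (μ.up_left_mem le_rfl (Nat.zero_le _) (L.mem x))
    -- The grading is the column reading of the bounding rectangle: a step to the right costs its
    -- full height, and rows differ by less than that.
    refine ⟨fun x => (μ.colLen 0 : ℤ) * L.col x + L.row x, μ.colLen 0, ?_, ?_, ?_⟩
    · intro x y h
      beta_reduce
      rw [h.1, h.2]
      push_cast
      ring
    · intro x y h
      beta_reduce
      have h1 := hrow x
      have h2 := hrow y
      simp only [TabPattern] at h
      change L.col x + 2 ≤ L.col y ∨ (L.col y = L.col x + 1 ∧ L.row x ≤ L.row y) ∨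
        (L.col y = L.col x ∧ L.row x < L.row y ∧ _) at h
      rcases lt_or_ge (L.col x) (L.col y) with h3 | h3
      · have : (μ.colLen 0 : ℤ) * (L.col x + 1) ≤ μ.colLen 0 * L.col y :=
          mul_le_mul_of_nonneg_left (by omega) (by omega)
        rw [mul_add, mul_one] at this
        omega
      · have h4 : L.col y = L.col x := by omega
        rw [h4]
        omega
    · intro x y h
      beta_reduce
      have h1 := hrow x
      have h2 := hrow y
      simp only [TabPattern] at h
      change ¬ (L.col x + 2 ≤ L.col y ∨ (L.col y = L.col x + 1 ∧ L.row x ≤ L.row y) ∨ _) at h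
      rcases lt_or_ge (L.col x) (L.col y) with h3 | h3
      · have h4 : L.col y = L.col x + 1 := by omega
        rw [h4]
        push_cast
        rw [mul_add, mul_one]
        omega
      · have : (μ.colLen 0 : ℤ) * L.col y ≤ μ.colLen 0 * L.col x :=
          mul_le_mul_of_nonneg_left (by omega) (by omega)
        omega
  card := L.card_eq _ (fun x y h1 h2 => by simp only [TabPattern] at h1 h2; omega)
    (card_tabPattern μ)

lemma isPolarization_ctrPattern :
    IsPolarization L.row L.col (fun i j => CtrPattern μ (L.cell i) (L.cell j)) where
  trans x y z h1 h2 := lt_trans h1 h2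
  not_next x y z h h1 h2 := by
    simp only [CtrPattern, ctrBlock, Next, row, col] at *
    rw [h.1, h.2] at h2
    omega
  exists_next y x h1 h2 := by
    rw [L.exists_next_iff]
    have hy := L.col_lt y
    have hx := L.col_lt x
    simp only [CtrPattern, ctrBlock] at h1
    change (L.col y : ℤ) - ((μ.rowLen (L.row y) / 2 : ℕ) : ℤ) <
      (L.col x : ℤ) - ((μ.rowLen (L.row x) / 2 : ℕ) : ℤ) at h1
    rcases le_total (L.row y) (L.row x) with h | h
    · have := μ.rowLen_anti _ _ h
      omega
    · have := μ.rowLen_anti _ _ h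
      omega
  grading := by
    -- The block number is itself a grading, raised by `1` along each arc.
    refine ⟨fun x => ctrBlock μ (L.cell x), 1, ?_, fun _ _ h => h, ?_⟩
    · intro x y h
      simp only [ctrBlock, Next, row, col] at *
      rw [h.1, h.2]
      push_cast
      ring
    · intro x y h
      simp only [CtrPattern] at h
      beta_reduce
      omega
  card := L.card_eq _ (fun x y h1 h2 => absurd h1 (not_lt.2 (le_of_lt h2))) (card_ctrPattern μ)

end Labelling

section Induction

variable {T : ℕ × ℕ → ℕ} (L : Labelling μ T) {F : Type*} [Field F]

lemma Labelling.trace_shiftMatrix_mul (X : Matrix (Fin μ.card) (Fin μ.card) F) :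
    (shiftMatrix L.row L.col F * X).trace = ∑ a ∈ rowArcs μ T, X a.1 a.2 := by
  classical
  have h1 : rowArcs μ T = Finset.univ.filter fun a => Next L.row L.col a.1 a.2 := by
    ext a
    rw [L.mem_rowArcs_iff]
    simp
  rw [h1, Finset.sum_filter, Fintype.sum_prod_type, Finset.sum_comm, Matrix.trace]
  refine Finset.sum_congr rfl fun y _ => ?_
  rw [Matrix.diag_apply, Matrix.mul_apply]
  refine Finset.sum_congr rfl fun x _ => ?_
  by_cases h : Next L.row L.col x y
  · simp [shiftMatrix, h]
  · simp [shiftMatrix, h]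

variable [Finite F]

/-- The function on the general linear group induced from the character of a pattern subgroup
attached to a polarization. -/
lemma Labelling.ind_map_patternSubgroup (ϑ : AddChar F ℂ) (hϑ : ϑ ≠ 1)
    [Fintype (Slice L.row L.col F)] [Fintype (GL (Fin μ.card) F)]
    {A : Fin μ.card → Fin μ.card → Prop} (hA : IsPolarization L.row L.col A)
    (P : Fin μ.card → Fin μ.card → Prop)
    (hP : ∀ i j k, i < j → j < k → P i j → P j k → P i k)
    (hPA : ∀ i j, i < j ∧ P i j ↔ A i j) (harcs : ∀ a ∈ rowArcs μ T, a.1 < a.2)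
    (g : GL (Fin μ.card) F) :
    ind ((patternSubgroup F P hP).map (UT μ.card F).subtype) (fun u => gam ϑ (rowArcs μ T) u.1) g =
      ((Nat.card F ^ Nat.card {p : Fin μ.card × Fin μ.card // A p.1 p.2} : ℕ) *
        (Nat.card F ^ Nat.card {p : Fin μ.card × Fin μ.card // SlicePos L.row L.col p.1 p.2} :
          ℕ) : ℂ)⁻¹ *
        ∑ s : Slice L.row L.col F, ∑ x : GL (Fin μ.card) F,
          ϑ (s.1 * (x.1 * (g.1 - 1) * (x⁻¹).1)).trace := by
  have := Fintype.ofFinite F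
  have hmem : ∀ g, g ∈ (patternSubgroup F P hP).map (UT μ.card F).subtype ↔
      ∀ i j, (g.1 - 1) i j ≠ 0 → A i j := by
    intro g
    constructor
    · rintro ⟨u, hu, rfl⟩ i j h
      exact (hPA i j).1 ⟨u.2 i j h, hu i j h⟩
    · intro h
      exact ⟨⟨g, fun i j hij => ((hPA i j).2 (h i j hij)).1⟩,
        fun i j hij => ((hPA i j).2 (h i j hij)).2, rfl⟩
  have hcard : Nat.card ((patternSubgroup F P hP).map (UT μ.card F).subtype) =
      Nat.card F ^ Nat.card {p : Fin μ.card × Fin μ.card // A p.1 p.2} := by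
    rw [Subgroup.card_map_of_injective (UT μ.card F).subtype_injective, card_patternSubgroup,
      Nat.card_congr (Equiv.subtypeEquivRight fun p : Fin μ.card × Fin μ.card => hPA p.1 p.2)]
  have h1 : (fun u : (patternSubgroup F P hP).map (UT μ.card F).subtype =>
      gam ϑ (rowArcs μ T) u.1) =
      fun u => ϑ (shiftMatrix L.row L.col F * (u.1.1 - 1)).trace := by
    funext u
    rw [gam_eq_sum ϑ _ harcs, L.trace_shiftMatrix_mul]
  rw [h1, sum_conj_eq_sum_slice L.isFilling hA ϑ hϑ _ hmem hcard, hcard, card_slice]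

/-- Polarizations for two labellings of the same diagram give the same induced function. -/
lemma Labelling.ind_eq_ind {T' : ℕ × ℕ → ℕ} (L' : Labelling μ T') (ϑ : AddChar F ℂ) (hϑ : ϑ ≠ 1)
    {A A' : Fin μ.card → Fin μ.card → Prop} (hA : IsPolarization L.row L.col A)
    (hA' : IsPolarization L'.row L'.col A') (P P' : Fin μ.card → Fin μ.card → Prop)
    (hP : ∀ i j k, i < j → j < k → P i j → P j k → P i k)
    (hP' : ∀ i j k, i < j → j < k → P' i j → P' j k → P' i k)
    (hPA : ∀ i j, i < j ∧ P i j ↔ A i j) (hPA' : ∀ i j, i < j ∧ P' i j ↔ A' i j)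
    (harcs : ∀ a ∈ rowArcs μ T, a.1 < a.2) (harcs' : ∀ a ∈ rowArcs μ T', a.1 < a.2) :
    ind ((patternSubgroup F P hP).map (UT μ.card F).subtype) (fun u => gam ϑ (rowArcs μ T) u.1) =
      ind ((patternSubgroup F P' hP').map (UT μ.card F).subtype)
        (fun u => gam ϑ (rowArcs μ T') u.1) := by
  classical
  have := Fintype.ofFinite F
  have := Fintype.ofFinite (Slice L.row L.col F)
  have := Fintype.ofFinite (Slice L'.row L'.col F)
  funext g
  rw [L.ind_map_patternSubgroup ϑ hϑ hA P hP hPA harcs,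
    L'.ind_map_patternSubgroup ϑ hϑ hA' P' hP' hPA' harcs']
  have hinj : Function.Injective (fun i => (L'.surj (L.cell i) (L.mem i)).choose) := by
    intro i j h
    apply L.cell_injective
    rw [← (L'.surj (L.cell i) (L.mem i)).choose_spec, ← (L'.surj (L.cell j) (L.mem j)).choose_spec]
    exact congrArg L'.cell h
  let σ : Equiv.Perm (Fin μ.card) := Equiv.ofBijective _ (Finite.injective_iff_bijective.1 hinj)
  have hσ : ∀ i, L'.cell (σ i) = L.cell i := fun i =>
    (L'.surj (L.cell i) (L.mem i)).choose_spec
  have hrow : ∀ i, L'.row (σ i) = L.row i := fun i => congrArg Prod.fst (hσ i)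
  have hcol : ∀ i, L'.col (σ i) = L.col i := fun i => congrArg Prod.snd (hσ i)
  have h1 : Nat.card {p : Fin μ.card × Fin μ.card // SlicePos L.row L.col p.1 p.2} =
      Nat.card {p : Fin μ.card × Fin μ.card // SlicePos L'.row L'.col p.1 p.2} :=
    Nat.card_congr ((Equiv.prodCongr σ σ).subtypeEquiv fun p =>
      (slicePos_relabel σ hrow hcol p.1 p.2).symm)
  -- The slices have equal size, so the count forces the two patterns to have equal size.
  have h2 : Nat.card {p : Fin μ.card × Fin μ.card // A p.1 p.2} =
      Nat.card {p : Fin μ.card × Fin μ.card // A' p.1 p.2} := by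
    have h3 := hA.card
    have h4 := hA'.card
    omega
  rw [h1, h2, sum_slice_relabel σ hrow hcol]

end Induction

end Labellings

/-! ### The blocks of the composition `ctr(μ')`. -/

section CtrComposition

/-- Each further column goes to the front or to the back according to parity. The closed form is the
folding of blocks onto columns used in `card_ctrPattern`. -/
lemma ctrOrder_eq (m : ℕ) : ctrOrder m =
    (List.range m).map fun t => if t < m / 2 then 2 * (m / 2 - t) - 1 else 2 * (t - m / 2) := by
  induction m with
  | zero => simp [ctrOrder]
  | succ m ih =>
    rcases Nat.mod_two_eq_zero_or_one (m + 1) with h | h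
    · have h1 : ctrOrder (m + 1) = m :: ctrOrder m := by
        simp [ctrOrder, List.range_succ, h]
      rw [h1, ih, List.range_succ_eq_map, List.map_cons, List.map_map]
      congr 1
      · rw [if_pos (by omega)]
        omega
      · refine List.map_congr_left fun t _ => ?_
        simp only [Function.comp_apply]
        split_ifs <;> omega
    · have h1 : ctrOrder (m + 1) = ctrOrder m ++ [m] := by
        simp [ctrOrder, List.range_succ, h]
      rw [h1, ih, List.range_succ, List.map_append, List.map_singleton]
      congr 1
      · refine List.map_congr_left fun t _ => ?_
        split_ifs <;> omega
      · rw [if_neg (by omega)]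
        congr 1
        omega

variable (μ : YoungDiagram)

lemma card_ctrBlock_eq (k : ℕ) :
    (μ.cells.filter fun x => ctrBlock μ x = (k : ℤ) - ((μ.rowLen 0 / 2 : ℕ) : ℤ)).card =
      μ.colLen (if k < μ.rowLen 0 / 2 then 2 * (μ.rowLen 0 / 2 - k) - 1
        else 2 * (k - μ.rowLen 0 / 2)) := by
  rw [YoungDiagram.colLen_eq_card]
  refine Finset.card_nbij' (fun x => (x.1, if k < μ.rowLen 0 / 2 then 2 * (μ.rowLen 0 / 2 - k) - 1
        else 2 * (k - μ.rowLen 0 / 2))) (fun x => (x.1, k + μ.rowLen x.1 / 2 - μ.rowLen 0 / 2))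
    ?_ ?_ ?_ ?_
  all_goals
    rintro ⟨a, b⟩ h
    simp only [Finset.coe_filter, YoungDiagram.mem_cells, Set.mem_ofPred_eq, Finset.mem_coe,
      YoungDiagram.mem_col_iff, YoungDiagram.mem_iff_lt_rowLen] at h ⊢
    try simp only [ctrBlock, Prod.mk.injEq, true_and, and_true] at h ⊢
    try rw [YoungDiagram.mem_iff_lt_rowLen]
    generalize μ.rowLen a = m at *
    generalize μ.rowLen 0 = m' at *
    try split_ifs at *
    all_goals omega

lemma neg_le_ctrBlock {x : ℕ × ℕ} : -((μ.rowLen 0 / 2 : ℕ) : ℤ) ≤ ctrBlock μ x := by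
  have := μ.rowLen_anti 0 x.1 (Nat.zero_le _)
  rw [ctrBlock]
  omega

lemma ctrBlock_le {x : ℕ × ℕ} (hx : x ∈ μ) :
    ctrBlock μ x ≤ (μ.rowLen 0 : ℤ) - ((μ.rowLen 0 / 2 : ℕ) : ℤ) := by
  have := μ.rowLen_anti 0 x.1 (Nat.zero_le _)
  have : x.2 < μ.rowLen x.1 := YoungDiagram.mem_iff_lt_rowLen.1 hx
  rw [ctrBlock]
  omega

/-- Partial sums count the cells in an initial run of blocks; the minimum accounts for `take` beyond
the end of the list. -/
lemma sum_take_ctrComposition (k : ℕ) : ((ctrComposition μ).take k).sum =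
    (μ.cells.filter fun x =>
      ctrBlock μ x < ((min k (μ.rowLen 0) : ℕ) : ℤ) - ((μ.rowLen 0 / 2 : ℕ) : ℤ)).card := by
  rw [ctrComposition, ctrOrder_eq, ← List.map_take, ← List.map_take, List.take_range, List.map_map]
  generalize min k (μ.rowLen 0) = l
  induction l with
  | zero =>
    rw [List.range_zero, List.map_nil, List.sum_nil, eq_comm, Finset.card_eq_zero,
      Finset.filter_eq_empty_iff]
    intro x _
    have := neg_le_ctrBlock μ (x := x)
    push_cast
    push_cast at this
    omega
  | succ l ih =>
    rw [List.range_succ, List.map_append, List.sum_append, ih, List.map_singleton,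
      List.sum_singleton, Function.comp_apply, ← card_ctrBlock_eq,
      ← Finset.card_union_of_disjoint, ← Finset.filter_or]
    · congr 1
      refine Finset.filter_congr fun x _ => ?_
      push_cast
      omega
    · rw [Finset.disjoint_filter]
      intro x _ h1 h2
      omega

/-- A reading order that refines `b` puts the cells with `b < β` into an initial segment, so
membership is decided by comparing the entry with its size. -/
lemma reading_lt_card_filter (key : ℕ × ℕ → ℕ ×ₗ ℕ) (b : ℕ × ℕ → ℤ)
    (hb : ∀ c ∈ μ, ∀ d ∈ μ, b c < b d → key c < key d) {c : ℕ × ℕ} (hc : c ∈ μ) (β : ℤ) :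
    reading μ key c < (μ.cells.filter fun x => b x < β).card ↔ b c < β := by
  constructor
  · intro h
    by_contra hcb
    refine absurd h (not_lt.2 (Finset.card_le_card fun d hd => ?_))
    rw [Finset.mem_filter] at hd ⊢
    exact ⟨hd.1, hb d hd.1 c hc (lt_of_lt_of_le hd.2 (not_lt.1 hcb))⟩
  · intro h
    refine Finset.card_lt_card (Finset.ssubset_iff_of_subset ?_ |>.2 ⟨c, ?_, ?_⟩)
    · intro d hd
      rw [Finset.mem_filter] at hd ⊢
      refine ⟨hd.1, lt_of_le_of_lt (not_lt.1 fun hlt => ?_) h⟩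
      exact lt_asymm hd.2 (hb c hc d hd.1 hlt)
    · rw [Finset.mem_filter]
      exact ⟨hc, h⟩
    · simp

end CtrComposition

/-! ### The column and half-column readings. -/

section ConcreteLabellings

variable (μ : YoungDiagram)

/-- The column reading labelling. -/
noncomputable def colLabelling : Labelling μ (colTableau μ) :=
  readingLabelling colKey fun c _ d _ h => by
    have h1 := congrArg (fun x => (ofLex x).1) h
    have h2 := congrArg (fun x => (ofLex x).2) h
    exact Prod.ext h2 h1

/-- The half-column reading labelling. -/
noncomputable def halfColLabelling : Labelling μ (reading μ (halfColKey μ)) :=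
  readingLabelling (halfColKey μ) fun c _ d _ h => by
    have h1 : 2 * c.2 + (μ.rowLen 0 - μ.rowLen c.1) = 2 * d.2 + (μ.rowLen 0 - μ.rowLen d.1) :=
      congrArg (fun x => (ofLex x).1) h
    have h2 : c.1 = d.1 := congrArg (fun x => (ofLex x).2) h
    rw [h2] at h1
    exact Prod.ext h2 (by omega)

lemma Labelling.lt_iff {key : ℕ × ℕ → ℕ ×ₗ ℕ} (L : Labelling μ (reading μ key))
    (i j : Fin μ.card) : i < j ↔ key (L.cell i) < key (L.cell j) := by
  rw [← reading_lt_iff μ (L.mem i), L.apply_cell, L.apply_cell]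
  rfl

lemma colLabelling_lt_iff (i j : Fin μ.card) : i < j ↔
    ((colLabelling μ).cell i).2 < ((colLabelling μ).cell j).2 ∨
      ((colLabelling μ).cell i).2 = ((colLabelling μ).cell j).2 ∧
        ((colLabelling μ).cell i).1 < ((colLabelling μ).cell j).1 := by
  rw [Labelling.lt_iff μ (colLabelling μ) i j]
  simp [colKey, Prod.Lex.toLex_lt_toLex]

lemma halfColKey_lt_of_ctrBlock_lt {c d : ℕ × ℕ} (h : ctrBlock μ c < ctrBlock μ d) :
    halfColKey μ c < halfColKey μ d := by
  rw [halfColKey, halfColKey, Prod.Lex.toLex_lt_toLex]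
  left
  have h1 := μ.rowLen_anti 0 c.1 (Nat.zero_le _)
  have h2 := μ.rowLen_anti 0 d.1 (Nat.zero_le _)
  simp only [ctrBlock] at h
  simp only
  omega

lemma compositionSubgroup_pattern_iff (i j : Fin μ.card) :
    (∃ k, (i : ℕ) < ((ctrComposition μ).take k).sum ∧ ((ctrComposition μ).take k).sum ≤ (j : ℕ)) ↔
      CtrPattern μ ((halfColLabelling μ).cell i) ((halfColLabelling μ).cell j) := by
  have h1 : ∀ (i : Fin μ.card) (k : ℕ), (i : ℕ) < ((ctrComposition μ).take k).sum ↔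
      ctrBlock μ ((halfColLabelling μ).cell i) <
        ((min k (μ.rowLen 0) : ℕ) : ℤ) - ((μ.rowLen 0 / 2 : ℕ) : ℤ) := by
    intro i k
    rw [sum_take_ctrComposition, ← reading_lt_card_filter μ (halfColKey μ) (ctrBlock μ)
      (fun _ _ _ _ h => halfColKey_lt_of_ctrBlock_lt μ h) ((halfColLabelling μ).mem i),
      (halfColLabelling μ).apply_cell]
  have h2 : ∀ k, ((ctrComposition μ).take k).sum ≤ (j : ℕ) ↔
      ¬ ctrBlock μ ((halfColLabelling μ).cell j) <
        ((min k (μ.rowLen 0) : ℕ) : ℤ) - ((μ.rowLen 0 / 2 : ℕ) : ℤ) := fun k => by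
    rw [← h1, not_lt]
  simp only [h1, h2, CtrPattern]
  constructor
  · rintro ⟨k, h3, h4⟩
    omega
  · intro h
    have h4 := neg_le_ctrBlock μ (x := (halfColLabelling μ).cell j)
    have h3 := ctrBlock_le μ ((halfColLabelling μ).mem j)
    -- Blocks start at `-(μ.rowLen 0 / 2)`, so this is the number of blocks before that of `j`.
    refine ⟨(ctrBlock μ ((halfColLabelling μ).cell j) + ((μ.rowLen 0 / 2 : ℕ) : ℤ)).toNat, ?_, ?_⟩
    all_goals omega

/-- The pattern of `V_T`. -/
def armPattern (i j : Fin μ.card) : Prop :=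
  (∃ k, (i, k) ∈ (sp μ).arcs ∧ i < j ∧ j < k) ∧
    ∃ c ∈ μ, ∃ d ∈ μ, colTableau μ c = i ∧ colTableau μ d = j ∧ c.1 < d.1

lemma mem_sp_iff (a : Fin μ.card × Fin μ.card) : a ∈ (sp μ).arcs ↔
    Next (colLabelling μ).row (colLabelling μ).col a.1 a.2 :=
  (colLabelling μ).mem_rowArcs_iff a

lemma armPattern_iff (i j : Fin μ.card) : armPattern μ i j ↔
    ((colLabelling μ).col j = (colLabelling μ).col i ∧
      (colLabelling μ).row i < (colLabelling μ).row j ∧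
        (colLabelling μ).col i + 1 < μ.rowLen ((colLabelling μ).row i)) := by
  rw [← Labelling.exists_next_iff]
  constructor
  · rintro ⟨⟨k, hk, hij, hjk⟩, ⟨r, c⟩, hc, ⟨r', c'⟩, hd, h1, h2, h3⟩
    rw [mem_sp_iff] at hk
    rw [colLabelling_lt_iff] at hij hjk
    obtain ⟨h4, -⟩ := colTableau_inj μ ((colLabelling μ).mem i) hc
      (((colLabelling μ).apply_cell i).trans h1.symm)
    obtain ⟨h5, -⟩ := colTableau_inj μ ((colLabelling μ).mem j) hd
      (((colLabelling μ).apply_cell j).trans h2.symm)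
    have h6 : (colLabelling μ).row i < (colLabelling μ).row j := by
      change ((colLabelling μ).cell i).1 < ((colLabelling μ).cell j).1
      exact lt_of_eq_of_lt h4 (lt_of_lt_of_eq h3 h5.symm)
    simp only [Next, Labelling.row, Labelling.col] at hk h6 ⊢
    exact ⟨by omega, h6, k, hk⟩
  · rintro ⟨h1, h2, k, hk⟩
    refine ⟨⟨k, (mem_sp_iff μ _).2 hk, ?_, ?_⟩, _, (colLabelling μ).mem i, _,
      (colLabelling μ).mem j, (colLabelling μ).apply_cell i, (colLabelling μ).apply_cell j, h2⟩
    · rw [colLabelling_lt_iff]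
      exact Or.inr ⟨h1.symm, h2⟩
    · rw [colLabelling_lt_iff]
      have := hk.2
      simp only [Labelling.col] at this h1
      exact Or.inl (by omega)

lemma isArmPattern : IsArmPattern (sp μ) (armPattern μ) where
  trans i j k _ _ h1 h2 := by
    rw [armPattern_iff] at *
    omega
  arc i j h := h.1
  not_arc i j k h h1 h2 := by
    rw [mem_sp_iff] at h
    rw [armPattern_iff] at h1 h2
    have := h.2
    simp only at this
    omega

/-- The covered positions are those within a column and those from a column to a strictly higher row
of the next. A second column is needed for an arc to cover the former. -/
lemma armPattern_or_uncovered_iff (hμ : μ.card ≤ 1 ∨ 2 ≤ μ.rowLen 0) (i j : Fin μ.card) :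
    (i < j ∧ (armPattern μ i j ∨ Uncovered (sp μ) i j)) ↔
      TabPattern μ ((colLabelling μ).cell i) ((colLabelling μ).cell j) := by
  have hTab : TabPattern μ ((colLabelling μ).cell i) ((colLabelling μ).cell j) → i < j := by
    rw [colLabelling_lt_iff, TabPattern]
    omega
  suffices hU : i < j → (Uncovered (sp μ) i j ↔
      ((colLabelling μ).col i + 2 ≤ (colLabelling μ).col j ∨
        ((colLabelling μ).col j = (colLabelling μ).col i + 1 ∧
          (colLabelling μ).row i ≤ (colLabelling μ).row j))) by
    constructor
    · rintro ⟨h1, h2⟩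
      rw [hU h1, armPattern_iff] at h2
      rw [TabPattern]
      simp only [Labelling.row, Labelling.col] at h2
      omega
    · intro h
      have h1 := hTab h
      refine ⟨h1, ?_⟩
      rw [hU h1, armPattern_iff]
      rw [TabPattern] at h
      simp only [Labelling.row, Labelling.col]
      omega
  intro hij
  have hn : 2 ≤ μ.rowLen 0 := hμ.resolve_left fun h => by
    have := i.2
    have := j.2
    have : (i : ℕ) < j := hij
    omega
  have hle : ∀ a b : Fin μ.card, a ≤ b ↔
      ¬ ((colLabelling μ).col b < (colLabelling μ).col a ∨
        (colLabelling μ).col b = (colLabelling μ).col a ∧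
          (colLabelling μ).row b < (colLabelling μ).row a) := by
    intro a b
    rw [← not_lt, colLabelling_lt_iff]
    rfl
  have hlt : (colLabelling μ).col i < (colLabelling μ).col j ∨
      (colLabelling μ).col i = (colLabelling μ).col j ∧
        (colLabelling μ).row i < (colLabelling μ).row j := (colLabelling_lt_iff μ i j).1 hij
  have hci := (colLabelling μ).col_lt i
  have hcj := (colLabelling μ).col_lt j
  constructor
  · intro h
    by_contra hcon
    have hcover : ∀ r c, c + 1 < μ.rowLen r →
        ((colLabelling μ).col i = (colLabelling μ).col j ∨
          r ≠ (colLabelling μ).row i) →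
        ¬ ((colLabelling μ).col i < c ∨ (colLabelling μ).col i = c ∧
          (colLabelling μ).row i < r) →
        ¬ (c + 1 < (colLabelling μ).col j ∨ c + 1 = (colLabelling μ).col j ∧
          r < (colLabelling μ).row j) → False := by
      intro r c hrc hne h1 h2
      obtain ⟨x, hx1, hx2⟩ := (colLabelling μ).exists_of_lt (r := r) (c := c) (by omega)
      obtain ⟨y, hy1, hy2⟩ := (colLabelling μ).exists_of_lt hrc
      refine h ⟨(x, y), (mem_sp_iff μ _).2 ⟨hy1.trans hx1.symm, by simp only; omega⟩, ?_, ?_, ?_⟩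
      · intro he
        rw [Prod.mk.injEq] at he
        rw [he.1] at hx1 hx2
        rw [he.2] at hy2
        omega
      · rw [hle]
        simp only [hx1, hx2]
        exact h1
      · rw [hle]
        simp only [hy1, hy2]
        exact h2
    rcases Nat.lt_or_ge ((colLabelling μ).col i) ((colLabelling μ).col j) with h1 | h1
    -- In adjacent columns with `j` strictly higher, the arc ending at `j` starts above `i`.
    · exact hcover ((colLabelling μ).row j) ((colLabelling μ).col i) (by omega) (by omega) (by omega)
        (by omega)
    · rcases Nat.lt_or_ge ((colLabelling μ).col i + 1) (μ.rowLen 0) with h2 | h2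
      -- Within a column that is not the last, the arc from its top cell covers every pair.
      · exact hcover 0 ((colLabelling μ).col i) h2 (by omega) (by omega) (by omega)
      -- In the last column, the arc ending at `j` starts in the previous column, which exists
      -- because the first row has at least two cells.
      · exact hcover ((colLabelling μ).row j) ((colLabelling μ).col i - 1) (by omega) (by omega)
          (by omega) (by omega)
  · rintro h ⟨⟨x, y⟩, ha, hne, h1, h2⟩
    rw [mem_sp_iff] at ha
    rw [hle] at h1 h2
    obtain ⟨h3, h4⟩ := ha
    simp only at h1 h2 h3 h4
    apply hne
    refine Prod.ext ((colLabelling μ).isFilling.inj _ _ ?_ ?_)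
      ((colLabelling μ).isFilling.inj _ _ ?_ ?_)
    all_goals simp only
    all_goals omega

end ConcreteLabellings

/-! ### Assembly of the theorem. -/

section MainTheorem

variable (μ : YoungDiagram) (F : Type*) [Field F] [Finite F]

lemma UTab_eq : UTab μ F = patternSubgroup F
      (fun i j => armPattern μ i j ∨ Uncovered (sp μ) i j) (isArmPattern μ).sup_trans ∧
    Nat.card (UTab μ F) = Nat.card (VT μ F) * Nat.card (setPartitionSubgroup F (sp μ)) := by
  obtain ⟨h1, h2⟩ := patternSubgroup_sup (F := F) (armPattern μ) (Uncovered (sp μ))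
    (isArmPattern μ).trans (fun i j k hij hjk h _ => h.right hjk) (isArmPattern μ).sup_trans
    (fun i j _ h => (isArmPattern μ).disjoint i j h)
  have h3 : UTab μ F = patternSubgroup F
      (fun i j => armPattern μ i j ∨ Uncovered (sp μ) i j) (isArmPattern μ).sup_trans := h1
  exact ⟨h3, by rw [h3]; exact h2⟩

lemma mem_UTab_iff (u : UT μ.card F) :
    u ∈ UTab μ F ↔ IsArmPattern.Mem (armPattern μ) (sp μ) u.1 := by
  rw [(UTab_eq μ F).1]
  exact ⟨fun h i j hij => ⟨u.2 i j hij, h i j hij⟩, fun h i j hij => (h i j hij).2⟩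

variable {F}

/-- The linear character `γ_{sp(T)}` of `U_T`. -/
noncomputable def tabHom (ϑ : AddChar F ℂ) : UTab μ F →* ℂˣ :=
  gamHom ϑ (sp μ).arcs (sp μ).lt (fun i j => i < j ∧ (armPattern μ i j ∨ Uncovered (sp μ) i j))
    (isArmPattern μ).not_decomposable (UTab μ F) fun u hu => (mem_UTab_iff μ F u).1 hu

lemma tabHom_apply (ϑ : AddChar F ℂ) (u : UTab μ F) :
    (tabHom μ ϑ u : ℂ) = gam ϑ (sp μ).arcs u.1.1 := rfl

lemma scaledSupercharacter_eq_ind (ϑ : AddChar F ℂ) (hϑ : ϑ ≠ 1) :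
    scaledSupercharacter μ ϑ = ind (UTab μ F) (fun u => gam ϑ (sp μ).arcs u.1.1) :=
  funext fun u => (isArmPattern μ).ind_eq ϑ hϑ (UTab μ F) (mem_UTab_iff μ F) _ (UTab_eq μ F).2 u

/-- By transitivity, both sides are induced from pattern subgroups of polarizations for two
labellings of the same diagram, so `Labelling.ind_eq_ind` applies. -/
lemma ind_scaledSupercharacter (ϑ : AddChar F ℂ) (hϑ : ϑ ≠ 1)
    (hμ : μ.card ≤ 1 ∨ 2 ≤ μ.rowLen 0) :
    ind (UT μ.card F) (scaledSupercharacter μ ϑ) = gggCharacter μ ϑ := by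
  rw [scaledSupercharacter_eq_ind μ ϑ hϑ, ind_ind (UT μ.card F) (UTab μ F)
    (fun u => gam ϑ (sp μ).arcs u), (UTab_eq μ F).1]
  refine (colLabelling μ).ind_eq_ind (halfColLabelling μ) ϑ hϑ
    (colLabelling μ).isPolarization_tabPattern (halfColLabelling μ).isPolarization_ctrPattern
    _ _ _ _ (armPattern_or_uncovered_iff μ hμ) ?_ (sp μ).lt ?_
  · intro i j
    rw [compositionSubgroup_pattern_iff, and_iff_right_iff_imp]
    intro h
    exact (Labelling.lt_iff μ (halfColLabelling μ) i j).2 (halfColKey_lt_of_ctrBlock_lt μ h)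
  · intro a ha
    rw [(halfColLabelling μ).mem_rowArcs_iff] at ha
    refine (Labelling.lt_iff μ (halfColLabelling μ) _ _).2 (halfColKey_lt_of_ctrBlock_lt μ ?_)
    have h1 : ((halfColLabelling μ).cell a.2).1 = ((halfColLabelling μ).cell a.1).1 := ha.1
    have h2 : ((halfColLabelling μ).cell a.2).2 = ((halfColLabelling μ).cell a.1).2 + 1 := ha.2
    rw [ctrBlock, ctrBlock, h1, h2]
    omega

end MainTheorem

end GGG

theorem mainTheorem4 {F : Type*} [Field F] [Finite F] (ϑ : AddChar F ℂ) (hϑ : ϑ ≠ 1)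
    (μ : YoungDiagram) :
    -- `γ_{sp(T)}` defines a linear character of `U_T`, from which the scaled character is induced
    (∃ γ : GGG.UTab μ F →* ℂˣ,
      (∀ u, (γ u : ℂ) = GGG.gam ϑ (GGG.sp μ).arcs u.1.1) ∧
      GGG.scaledSupercharacter μ ϑ = GGG.ind (GGG.UTab μ F) (fun u => (γ u : ℂ))) ∧
    GGG.IsCharacter (GGG.scaledSupercharacter μ ϑ) ∧
    -- if `μ` is not a single column of at least two cells, it induces to `Γ_μ`
    ((μ.card ≤ 1 ∨ 2 ≤ μ.rowLen 0) →
      GGG.ind (GGG.UT μ.card F) (GGG.scaledSupercharacter μ ϑ) = GGG.gggCharacter μ ϑ) := by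
  have h : GGG.scaledSupercharacter μ ϑ =
      GGG.ind (GGG.UTab μ F) (fun u => (GGG.tabHom μ ϑ u : ℂ)) :=
    GGG.scaledSupercharacter_eq_ind μ ϑ hϑ
  refine ⟨⟨GGG.tabHom μ ϑ, GGG.tabHom_apply μ ϑ, h⟩, ?_, GGG.ind_scaledSupercharacter μ ϑ hϑ⟩
  rw [h]
  exact GGG.isCharacter_ind _ _
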